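/- **Conventions.** A *Markov category* is a symmetric monoidal category $(\mathcal C,\otimes,I)$ in which every object $X$ carries a commutative comonoid structure $(\mathrm{copy}_X,\mathrm{del}_X)$, compatible with $\otimes$ and $I$, with $\mathrm{del}$ natural. A morphism is *deterministic* if it is a comonoid homomorphism; $\mathcal C_{\det}$ is the subcategory of deterministic morphisms. A *Markov functor* is a strong symmetric monoidal functor $F$ such that $F(X)\to F(X\otimes X)\cong F(X)\otimes F(X)$ equals $\mathrm{copy}_{F(X)}$ for every $X$. For an infinite regular cardinal $\kappa$, $\mathcal C$ is *$\kappa$-distributive* if $\mathcal C_{\det}$ has coproducts of all families indexed by sets of cardinality $<\kappa$, and these are preserved by the inclusion $\mathcal C_{\det}\to\mathcal C$ and by the functors $A\otimes-$. It is *distributive* (resp. *small-distributive*) if the same holds for finite (resp. all small) index sets. A *midpoint algebra* is a set $A$ with $m:A\times A\to A$ satisfying $m(a,a)=a$, $m(a,b)=m(b,a)$ and $m(m(a,b),m(c,d))=m(m(a,c),m(b,d))$. It is *iterable* if for every set $X$ and map $s:X\to X\times A$ there is a unique $u:X\to A$ with $u=m\circ(u\times A)\circ s$. A Markov category is *coinflip*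 if its hom-sets admit midpoint algebra structures for which pre- and postcomposition are midpoint homomorphisms; it is moreover *externally iterable* if these midpoint algebras are all iterable. Let $\mathsf{Set}_{\bar\Delta}$ be the Kleisli category of the countably supported probability distribution monad $\bar\Delta$ on sets (with the product of sets and of distributions as tensor, and copying given by the diagonal), $\mathsf{Set}_{\bar\Delta}^{<\kappa}$ its full subcategory on the sets of cardinality $<\kappa$, and $\mathsf{FinStoch}$ the Markov category of finite sets and stochastic matrices. **Theorem.** Let $\kappa$ be an infinite regular cardinal. Then $\mathsf{Set}_{\bar\Delta}^{<\kappa}$ is the (bi-)initial $\kappa$-distributive, externally iterable, coinflip Markov category. That is: it is itself such a category; for every such category $\mathcal C$ there is a Markov functor $\mathsf{Set}_{\bar\Delta}^{<\kappa}\to\mathcal C$ preserving coproducts indexed by sets of cardinality $<\kappa$; and between any two such functors there is exactly one monoidal natural transformation, which is an isomorphism. In particular, in the same sense, $\mathsf{FinStoch}$ is the initial distributive, externally iterable, coinflip Markov category (with Markov functors preserving finite coproducts), and $\mathsf{Set}_{\bar\Delta}$ is the initial small-distributive, externally iterable, coinflip Markov category (with Markov functors preserving small coproducts). -/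

import Mathlib

open CategoryTheory MonoidalCategory ComonObj Limits

universe u v v₁ u₁ v₂ u₂

/-! ### Deterministic morphisms and distributive Markov categories -/

section Markov

variable (C : Type u₁) [Category.{v₁} C] [MonoidalCategory C] [MarkovCategory C]

/-- The class of deterministic morphisms (comonoid homomorphisms) of a Markov category. -/
def deterministicMorphisms : MorphismProperty C := fun _ _ f => Deterministic f

instance : (deterministicMorphisms C).IsMultiplicative where
  id_mem X := inferInstanceAs (IsComonHom (𝟙 X))
  comp_mem f g hf hg := by
    have : IsComonHom f := hf
    have : IsComonHom g := hg
    exact inferInstanceAs (IsComonHom (f ≫ g))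

/-- The subcategory `C_det` of deterministic morphisms, with all objects of `C`. -/
abbrev Det := WideSubcategory (deterministicMorphisms C)

/-- The inclusion `C_det ⥤ C`. -/
abbrev Det.inclusion : Det C ⥤ C := wideSubcategoryInclusion (deterministicMorphisms C)

/-- Let `S` be a class of sets. A Markov category `C` is `S`-distributive if `C_det` has all
coproducts of families indexed by sets in `S`, and these coproducts are preserved by the inclusion
`C_det ⥤ C` and by the functors `A ⊗ -`. -/
structure IsDistributiveMarkov (S : Type u → Prop) : Prop where
  hasCoproducts (J : Type u) (hJ : S J) : HasColimitsOfShape (Discrete J) (Det C)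
  inclusion_preserves (J : Type u) (hJ : S J) :
    PreservesColimitsOfShape (Discrete J) (Det.inclusion C)
  tensor_preserves (J : Type u) (hJ : S J) (A : C) :
    PreservesColimitsOfShape (Discrete J) (tensorLeft A)

end Markov

/-! ### Midpoint algebras and coinflip structures -/

/-- A midpoint algebra (in the category of sets). -/
structure MidpointAlgebra (A : Type v) where
  m : A → A → A
  idem (a : A) : m a a = a
  comm (a b : A) : m a b = m b a
  interchange (a b c d : A) : m (m a b) (m c d) = m (m a c) (m b d)

/-- A midpoint algebra `A` is iterable if for every map of sets `s : X → X × A` there is a unique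
`t : X → A` with `t = m ∘ (t × A) ∘ s`. -/
def MidpointAlgebra.IsIterable {A : Type v} (M : MidpointAlgebra A) : Prop :=
  ∀ (X : Type v) (s : X → X × A), ∃! t : X → A, ∀ x, t x = M.m (t (s x).1) (s x).2

/-- A coinflip structure: a midpoint algebra structure on every hom-set such that both
precomposition and postcomposition are midpoint homomorphisms. -/
structure CoinflipStructure (C : Type u₁) [Category.{v₁} C] where
  midpoint (X Y : C) : MidpointAlgebra (X ⟶ Y)
  precomp {X Y Z : C} (h : X ⟶ Y) (f g : Y ⟶ Z) :
    h ≫ (midpoint Y Z).m f g = (midpoint X Z).m (h ≫ f) (h ≫ g)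
  postcomp {X Y Z : C} (f g : X ⟶ Y) (h : Y ⟶ Z) :
    (midpoint X Y).m f g ≫ h = (midpoint X Z).m (f ≫ h) (g ≫ h)

/-- `C` is a coinflip Markov category and its hom-sets, with the midpoint algebra structures of
the coinflip structure, are iterable in the category of sets. -/
def IsExternallyIterableCoinflip (C : Type u₁) [Category.{v₁} C] [MonoidalCategory C]
    [MarkovCategory C] : Prop :=
  ∃ M : CoinflipStructure C, ∀ X Y : C, (M.midpoint X Y).IsIterable

/-! ### Markov functors and initiality -/

/-- A (strong) Markov functor: a strong symmetric monoidal functor such that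
`F X ⟶ F (X ⊗ X) ⟶ F X ⊗ F X` is the copy map of `F X`. -/
structure MarkovFunctor (C : Type u₁) [Category.{v₁} C] [MonoidalCategory C] [MarkovCategory C]
    (D : Type u₂) [Category.{v₂} D] [MonoidalCategory D] [MarkovCategory D] extends C ⥤ D where
  braided : toFunctor.Braided
  map_copy (X : C) :
    toFunctor.map Δ[X] ≫ Functor.OplaxMonoidal.δ toFunctor X X = Δ[toFunctor.obj X]

attribute [instance] MarkovFunctor.braided

section

variable {C : Type u₁} [Category.{v₁} C] [MonoidalCategory C] [MarkovCategory C]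
  {D : Type u₂} [Category.{v₂} D] [MonoidalCategory D] [MarkovCategory D]

/-- The functor preserves coproducts of families indexed by sets in `S`. -/
def MarkovFunctor.PreservesCoproducts (F : MarkovFunctor C D) (S : Type u → Prop) : Prop :=
  ∀ J : Type u, S J → PreservesColimitsOfShape (Discrete J) F.toFunctor

end

/-- `I` is (bi-)initial among the `S`-distributive, externally iterable, coinflip Markov categories
(with objects and morphisms in the given universes) and Markov functors preserving `S`-indexed
coproducts: it is itself such a category, it admits such a functor into any other one, and between
any two such functors there is exactly one monoidal natural transformation, which is moreover an
isomorphism. -/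
structure IsInitialDistributiveIterableCoinflip (S : Type u → Prop)
    (I : Type u₁) [Category.{v₁} I] [MonoidalCategory I] [MarkovCategory I] : Prop where
  distributive : IsDistributiveMarkov I S
  iterable : IsExternallyIterableCoinflip I
  exists_functor (C : Type u₂) [Category.{v₂} C] [MonoidalCategory C] [MarkovCategory C]
    (hC : IsDistributiveMarkov C S) (hC' : IsExternallyIterableCoinflip C) :
    ∃ F : MarkovFunctor I C, F.PreservesCoproducts S
  unique_functor (C : Type u₂) [Category.{v₂} C] [MonoidalCategory C] [MarkovCategory C]
    (hC : IsDistributiveMarkov C S) (hC' : IsExternallyIterableCoinflip C)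
    (F G : MarkovFunctor I C) (hF : F.PreservesCoproducts S) (hG : G.PreservesCoproducts S) :
    ∃ e : F.toFunctor ≅ G.toFunctor, NatTrans.IsMonoidal e.hom ∧
      ∀ α : F.toFunctor ⟶ G.toFunctor, NatTrans.IsMonoidal α → α = e.hom

/-! ### The Kleisli category of the countably supported distribution monad -/

/-- A class of sets containing the one-point set and closed under binary products. -/
class ClosedUnderProducts (S : Type u → Prop) : Prop where
  punit : S PUnit
  prod (X Y : Type u) : S X → S Y → S (X × Y)

/-- Objects: the sets belonging to the class `S`. -/
structure DiscreteStoch (S : Type u → Prop) where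
  carrier : Type u
  mem : S carrier

namespace DiscreteStoch

variable {S : Type u → Prop}

/-- Morphisms `X ⟶ Y`: Kleisli maps `X → PMF Y`. (`PMF Y` is the set of functions `p : Y → [0, ∞]`
with sum `1`; such a `p` is automatically countably supported with values in `[0, 1]`.) -/
@[ext]
structure Hom (X Y : DiscreteStoch S) where
  ker : X.carrier → PMF Y.carrier

/-- Kleisli composition. -/
noncomputable instance : Category.{u} (DiscreteStoch S) where
  Hom := Hom
  id X := ⟨PMF.pure⟩
  comp f g := ⟨fun x => (f.ker x).bind g.ker⟩
  id_comp f := by apply Hom.ext; funext x; simp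
  comp_id f := by apply Hom.ext; funext x; simp
  assoc f g h := by apply Hom.ext; funext x; simp

@[ext]
theorem hom_ext {X Y : DiscreteStoch S} {f g : X ⟶ Y} (h : ∀ x, f.ker x = g.ker x) : f = g :=
  Hom.ext (funext h)

@[simp]
theorem id_ker (X : DiscreteStoch S) (x : X.carrier) : Hom.ker (𝟙 X) x = PMF.pure x := rfl

@[simp]
theorem comp_ker {X Y Z : DiscreteStoch S} (f : X ⟶ Y) (g : Y ⟶ Z) (x : X.carrier) :
    (f ≫ g).ker x = (f.ker x).bind g.ker := rfl

/-- The Kleisli morphism of a function. -/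
noncomputable def ofFun {X Y : DiscreteStoch S} (f : X.carrier → Y.carrier) : X ⟶ Y :=
  ⟨fun x => PMF.pure (f x)⟩

@[simp]
theorem ofFun_ker {X Y : DiscreteStoch S} (f : X.carrier → Y.carrier) (x : X.carrier) :
    (ofFun f : X ⟶ Y).ker x = PMF.pure (f x) := rfl

theorem ofFun_id (X : DiscreteStoch S) : (ofFun id : X ⟶ X) = 𝟙 X := rfl

theorem ofFun_comp {X Y Z : DiscreteStoch S} (f : X.carrier → Y.carrier) (g : Y.carrier → Z.carrier) :
    (ofFun f : X ⟶ Y) ≫ (ofFun g : Y ⟶ Z) = ofFun fun x => g (f x) := by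
  apply hom_ext
  intro x
  exact PMF.pure_bind _ _

/-- The isomorphism of a bijection. -/
@[simps]
noncomputable def isoOfEquiv {X Y : DiscreteStoch S} (e : X.carrier ≃ Y.carrier) : X ≅ Y where
  hom := ofFun e
  inv := ofFun e.symm

/-- The product of two distributions. -/
noncomputable def prodDist {X Y : Type u} (p : PMF X) (q : PMF Y) : PMF (X × Y) :=
  p.bind fun a => q.bind fun b => PMF.pure (a, b)

@[simp]
theorem prodDist_bind {X Y Z : Type u} (p : PMF X) (q : PMF Y) (k : X × Y → PMF Z) :
    (prodDist p q).bind k = p.bind fun a => q.bind fun b => k (a, b) := by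
  simp [prodDist]

@[simp]
theorem prodDist_pure {X Y : Type u} (x : X) (y : Y) :
    prodDist (PMF.pure x) (PMF.pure y) = PMF.pure (x, y) := by
  simp [prodDist]

theorem bind_prodDist {W X Y : Type u} (p : PMF W) (r : W → PMF X) (q : PMF Y) :
    prodDist (p.bind r) q = p.bind fun w => prodDist (r w) q := by
  simp [prodDist]

variable [hS : ClosedUnderProducts S]

/-- The tensor product is the product of sets, and the product of distributions on morphisms. -/
noncomputable instance : MonoidalCategoryStruct (DiscreteStoch S) where
  tensorObj X Y := ⟨X.carrier × Y.carrier, hS.prod _ _ X.mem Y.mem⟩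
  tensorUnit := ⟨PUnit, hS.punit⟩
  tensorHom f g := ⟨fun x => prodDist (f.ker x.1) (g.ker x.2)⟩
  whiskerLeft _ _ _ g := ⟨fun x => prodDist (PMF.pure x.1) (g.ker x.2)⟩
  whiskerRight f _ := ⟨fun x => prodDist (f.ker x.1) (PMF.pure x.2)⟩
  associator _ _ _ := isoOfEquiv (Equiv.prodAssoc _ _ _)
  leftUnitor _ := isoOfEquiv (Equiv.punitProd _)
  rightUnitor _ := isoOfEquiv (Equiv.prodPUnit _)

section

variable {W X Y Z : DiscreteStoch S}

@[simp]
theorem tensorHom_ker (f : W ⟶ X) (g : Y ⟶ Z) (x : W.carrier × Y.carrier) :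
    (f ⊗ₘ g).ker x = prodDist (f.ker x.1) (g.ker x.2) := rfl

@[simp]
theorem whiskerLeft_ker (g : Y ⟶ Z) (x : X.carrier × Y.carrier) :
    (X ◁ g).ker x = prodDist (PMF.pure x.1) (g.ker x.2) := rfl

@[simp]
theorem whiskerRight_ker (f : W ⟶ X) (x : W.carrier × Y.carrier) :
    (f ▷ Y).ker x = prodDist (f.ker x.1) (PMF.pure x.2) := rfl

@[simp]
theorem associator_hom :
    (α_ X Y Z).hom = ofFun (Equiv.prodAssoc X.carrier Y.carrier Z.carrier) := rfl

@[simp]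
theorem associator_inv :
    (α_ X Y Z).inv = ofFun (Equiv.prodAssoc X.carrier Y.carrier Z.carrier).symm := rfl

@[simp]
theorem leftUnitor_hom : (λ_ X).hom = ofFun (Equiv.punitProd X.carrier) := rfl

@[simp]
theorem leftUnitor_inv : (λ_ X).inv = ofFun (Equiv.punitProd X.carrier).symm := rfl

@[simp]
theorem rightUnitor_hom : (ρ_ X).hom = ofFun (Equiv.prodPUnit X.carrier) := rfl

@[simp]
theorem rightUnitor_inv : (ρ_ X).inv = ofFun (Equiv.prodPUnit X.carrier).symm := rfl

theorem ofFun_tensorHom (f : W.carrier → X.carrier) (g : Y.carrier → Z.carrier) :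
    (ofFun f : W ⟶ X) ⊗ₘ (ofFun g : Y ⟶ Z) =
      (ofFun fun x : W.carrier × Y.carrier => (f x.1, g x.2)) := by
  apply hom_ext
  intro x
  exact prodDist_pure _ _

theorem whiskerLeft_ofFun (g : Y.carrier → Z.carrier) :
    X ◁ (ofFun g : Y ⟶ Z) = (ofFun fun x : X.carrier × Y.carrier => (x.1, g x.2)) := by
  apply hom_ext
  intro x
  exact prodDist_pure _ _

theorem ofFun_whiskerRight (f : W.carrier → X.carrier) :
    (ofFun f : W ⟶ X) ▷ Y = (ofFun fun x : W.carrier × Y.carrier => (f x.1, x.2)) := by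
  apply hom_ext
  intro x
  exact prodDist_pure _ _

end

theorem tensorHom_comp_tensorHom' {X₁ Y₁ Z₁ X₂ Y₂ Z₂ : DiscreteStoch S} (f₁ : X₁ ⟶ Y₁)
    (f₂ : X₂ ⟶ Y₂) (g₁ : Y₁ ⟶ Z₁) (g₂ : Y₂ ⟶ Z₂) :
    (f₁ ⊗ₘ f₂) ≫ (g₁ ⊗ₘ g₂) = (f₁ ≫ g₁) ⊗ₘ (f₂ ≫ g₂) := by
  apply hom_ext
  intro x
  change (prodDist _ _).bind (fun x => prodDist (g₁.ker x.1) (g₂.ker x.2)) =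
    prodDist (PMF.bind _ _) (PMF.bind _ _)
  simp only [prodDist, PMF.bind_bind, PMF.pure_bind]
  congr 1
  funext a
  exact PMF.bind_comm _ (g₁.ker a) _

noncomputable instance : MonoidalCategory (DiscreteStoch S) :=
  MonoidalCategory.ofTensorHom
    (id_tensorHom_id := fun X Y => ofFun_tensorHom id id)
    (tensorHom_comp_tensorHom := tensorHom_comp_tensorHom')
    (id_tensorHom := fun X _ _ f => rfl)
    (tensorHom_id := fun f X => rfl)
    (associator_naturality := fun f g h => by
      apply hom_ext
      rintro ⟨⟨x, y⟩, z⟩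
      change (prodDist (prodDist (f.ker x) (g.ker y)) (h.ker z)).bind _ =
        (PMF.pure (x, y, z)).bind fun t =>
          prodDist (f.ker t.1) (prodDist (g.ker t.2.1) (h.ker t.2.2))
      simp only [prodDist, PMF.bind_bind, PMF.pure_bind]
      rfl)
    (leftUnitor_naturality := fun f => by
      apply hom_ext
      rintro ⟨x, y⟩
      change (prodDist (PMF.pure _) (f.ker y)).bind _ = (PMF.pure y).bind f.ker
      simp only [prodDist, PMF.bind_bind, PMF.pure_bind]
      exact PMF.bind_pure _)
    (rightUnitor_naturality := fun f => by
      apply hom_ext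
      rintro ⟨x, y⟩
      change (prodDist (f.ker x) (PMF.pure _)).bind _ = (PMF.pure x).bind f.ker
      simp only [prodDist, PMF.bind_bind, PMF.pure_bind]
      exact PMF.bind_pure _)
    (pentagon := fun W X Y Z => by
      simp only [associator_hom, ← ofFun_id, ofFun_tensorHom]
      erw [ofFun_comp, ofFun_comp, ofFun_comp]
      rfl)
    (triangle := fun X Y => by
      simp only [associator_hom, leftUnitor_hom, rightUnitor_hom, ← ofFun_id, ofFun_tensorHom]
      erw [ofFun_comp]
      rfl)

/-- The symmetry swaps the two factors. -/
noncomputable instance : SymmetricCategory (DiscreteStoch S) where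
  braiding _ _ := isoOfEquiv (Equiv.prodComm _ _)
  braiding_naturality_right X Y Z f := by
    apply hom_ext
    rintro ⟨x, y⟩
    change (prodDist (PMF.pure x) (f.ker y)).bind _ =
      (PMF.pure (y, x)).bind fun t => prodDist (f.ker t.1) (PMF.pure t.2)
    simp only [prodDist, PMF.bind_bind, PMF.pure_bind]
    rfl
  braiding_naturality_left f Z := by
    apply hom_ext
    rintro ⟨x, z⟩
    change (prodDist (f.ker x) (PMF.pure z)).bind _ =
      (PMF.pure (z, x)).bind fun t => prodDist (PMF.pure t.1) (f.ker t.2)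
    simp only [prodDist, PMF.bind_bind, PMF.pure_bind]
    rfl
  hexagon_forward X Y Z := by
    simp only [isoOfEquiv_hom, associator_hom, ofFun_whiskerRight, whiskerLeft_ofFun]
    erw [ofFun_comp, ofFun_comp, ofFun_comp, ofFun_comp]
    rfl
  hexagon_reverse X Y Z := by
    simp only [isoOfEquiv_hom, associator_inv, ofFun_whiskerRight, whiskerLeft_ofFun]
    erw [ofFun_comp, ofFun_comp, ofFun_comp, ofFun_comp]
    rfl
  symmetry X Y := by
    simp only [isoOfEquiv_hom]
    erw [ofFun_comp]
    rfl

theorem braiding_hom (X Y : DiscreteStoch S) :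
    (β_ X Y).hom = ofFun (Prod.swap : X.carrier × Y.carrier → Y.carrier × X.carrier) := rfl

theorem tensorμ_eq (W X Y Z : DiscreteStoch S) :
    tensorμ W X Y Z =
      (ofFun fun t : (W.carrier × X.carrier) × (Y.carrier × Z.carrier) =>
        ((t.1.1, t.2.1), (t.1.2, t.2.2))) := by
  simp only [tensorμ, associator_hom, associator_inv, braiding_hom]
  erw [ofFun_whiskerRight, whiskerLeft_ofFun, whiskerLeft_ofFun, whiskerLeft_ofFun, ofFun_comp,
    ofFun_comp, ofFun_comp, ofFun_comp]
  rfl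

/-- Copying is `x ↦ δ_(x, x)` and deletion is the unique map to the one-point set. -/
noncomputable abbrev comonoid (X : DiscreteStoch S) : ComonObj X where
  counit := ofFun fun _ => PUnit.unit
  comul := ofFun fun x => (x, x)
  counit_comul := by
    rw [ofFun_whiskerRight]
    erw [ofFun_comp]
    rfl
  comul_counit := by
    rw [whiskerLeft_ofFun]
    erw [ofFun_comp]
    rfl
  comul_assoc := by
    rw [whiskerLeft_ofFun, ofFun_whiskerRight, associator_hom]
    erw [ofFun_comp, ofFun_comp, ofFun_comp]
    rfl

section

attribute [local instance] comonoid

noncomputable instance : MarkovCategory (DiscreteStoch S) where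
  comonObj := comonoid
  isCommComonObj X := ⟨by
    change ofFun _ ≫ ofFun _ = ofFun _
    erw [ofFun_comp]
    rfl⟩
  copy_tensor X Y := by
    rw [tensorμ_eq]
    change ofFun _ = (ofFun _ ⊗ₘ ofFun _) ≫ ofFun _
    erw [ofFun_tensorHom, ofFun_comp]
    rfl
  discard_tensor X Y := by
    change ofFun _ = (ofFun _ ⊗ₘ ofFun _) ≫ ofFun _
    erw [ofFun_tensorHom, ofFun_comp]
    rfl
  copy_unit := rfl
  discard_unit := rfl
  discard_natural f := by
    apply hom_ext
    intro x
    exact PMF.bind_const _ _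

end

theorem copy_eq (X : DiscreteStoch S) :
    Δ[X] = (ofFun fun x : X.carrier => (x, x)) := rfl

theorem discard_eq (X : DiscreteStoch S) :
    ε[X] = (ofFun fun _ : X.carrier => PUnit.unit) := rfl

end DiscreteStoch

/-! ### The three examples -/

/-- The class of sets of cardinality less than `κ`. -/
def CardLT (κ : Cardinal.{u}) : Type u → Prop := fun X => Cardinal.mk X < κ

/-- The class of finite sets. -/
def IsFiniteSet : Type u → Prop := fun X => Finite X

/-- The class of all sets. -/
def IsSet : Type u → Prop := fun _ => True

instance (κ : Cardinal.{u}) [hκ : Fact κ.IsRegular] : ClosedUnderProducts (CardLT κ) where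
  punit := by
    change Cardinal.mk PUnit.{u + 1} < κ
    rw [Cardinal.mk_punit]
    exact Cardinal.one_lt_aleph0.trans_le hκ.out.aleph0_le
  prod X Y hX hY := by
    change Cardinal.mk (X × Y) < κ
    rw [← Cardinal.mul_def]
    exact Cardinal.mul_lt_of_lt hκ.out.aleph0_le hX hY

instance : ClosedUnderProducts IsFiniteSet.{u} where
  punit := inferInstanceAs (Finite PUnit)
  prod X Y hX hY := by
    have : Finite X := hX
    have : Finite Y := hY
    exact inferInstanceAs (Finite (X × Y))

instance : ClosedUnderProducts IsSet.{u} := ⟨trivial, fun _ _ _ _ => trivial⟩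

/-- The Kleisli category of the countably supported distribution monad, restricted to sets of
cardinality less than `κ`. -/
abbrev SetDistLT (κ : Cardinal.{u}) := DiscreteStoch (CardLT κ)

/-- The category of finite sets and stochastic matrices. -/
abbrev FinStoch := DiscreteStoch IsFiniteSet.{u}

/-- The Kleisli category of the countably supported distribution monad on the category of sets. -/
abbrev SetDist := DiscreteStoch IsSet.{u}

/-! Every set X is the X-indexed copower of the one-point set. A coproduct-preserving Markov functor
must therefore send X to the copower of the tensor unit by X, and a Kleisli map X ⟶ Y to an
X-indexed family of states of the copower by Y. Everything rests on turning a distribution on Y into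
such a state in a canonical way, with Dirac distributions going to the coproduct injections.

The tool is that `PMF Y` is the free iterable midpoint algebra on Y (`IsIterable.lift`,
`IsIterable.hom_ext`). Since 2p dominates a finitely supported dyadic distribution d
(`PMF.exists_dyadic_lt`), p is the midpoint of d and some q. Repeating this with q expands p as a
series of weights 2^(-n-1), and iterability sums the corresponding series in any iterable algebra A.
The delicate point is that the sum depends on p only. A dyadic d lying strictly below 2p on its
support can be split off any two expansions of p (`IsDyadicPartialSeries.exists_split`), leaving two
expansions of the same q. So the two sums satisfy one recursion, and iterability identifies them.
The finite rearrangements used here rest on `Avg.unique`: a balanced average depends only on the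
multiset of its leaves.

With A the set of states of a copower, this defines the functor. Functoriality and compatibility
with tensor products are equalities of midpoint homomorphisms, checked on Dirac distributions. For
uniqueness, an Eckmann–Hilton argument (`CoinflipStructure.map_midpoint`) shows that preserving
two-fold copowers forces preservation of midpoints. Hence the isomorphism matching coproduct
injections is natural and monoidal. Any monoidal transformation matches these injections, because it
is compatible with the unit. -/

/-! ### Dyadic averages in a midpoint algebra -/

namespace MidpointAlgebra

/-- The componentwise midpoint algebra on a product. -/
def prod {A : Type u} {B : Type v} (M : MidpointAlgebra A) (N : MidpointAlgebra B) :
    MidpointAlgebra (A × B) where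
  m a b := (M.m a.1 b.1, N.m a.2 b.2)
  idem a := by simp [M.idem, N.idem]
  comm a b := by simp [M.comm a.1, N.comm a.2]
  interchange a b c d := by
    simp only [M.interchange a.1 b.1, N.interchange a.2 b.2]

/-- `M.Avg h n s a` says that `a` is the average of the values of `h` at the `2 ^ n` elements
of `s`, computed along some balanced binary tree. -/
inductive Avg {A : Type v} {I : Type u} (M : MidpointAlgebra A) (h : I → A) :
    ℕ → Multiset I → A → Prop
  | leaf (i : I) : Avg M h 0 {i} (h i)
  | node {n : ℕ} {s t : Multiset I} {a b : A} (hs : Avg M h n s a) (ht : Avg M h n t b) :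
      Avg M h (n + 1) (s + t) (M.m a b)

variable {A : Type v} {I : Type u} {M : MidpointAlgebra A} {h : I → A}

theorem Avg.card {n : ℕ} {s : Multiset I} {a : A} (H : M.Avg h n s a) : s.card = 2 ^ n := by
  induction H with
  | leaf i => simp
  | node hs ht ihs iht => rw [Multiset.card_add, ihs, iht, pow_succ, mul_two]

theorem exists_add_of_le_card (s : Multiset I) (n : ℕ) (hn : n ≤ s.card) :
    ∃ t u, s = t + u ∧ t.card = n := by
  induction s using Quotient.inductionOn with
  | h l =>
    refine ⟨(l.take n : List I), (l.drop n : List I), ?_, ?_⟩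
    · simp
    · simpa using hn

theorem exists_avg (M : MidpointAlgebra A) (h : I → A) (n : ℕ) (s : Multiset I)
    (hs : s.card = 2 ^ n) : ∃ a, M.Avg h n s a := by
  induction n generalizing s with
  | zero =>
    obtain ⟨i, rfl⟩ := Multiset.card_eq_one.1 (by simpa using hs)
    exact ⟨_, .leaf i⟩
  | succ n ih =>
    rw [pow_succ] at hs
    obtain ⟨t, u, rfl, ht⟩ := exists_add_of_le_card s (2 ^ n) (by omega)
    rw [Multiset.card_add] at hs
    obtain ⟨a, ha⟩ := ih t ht
    obtain ⟨b, hb⟩ := ih u (by omega)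
    exact ⟨_, .node ha hb⟩

/-- Independence of the tree and the freedom to swap a leaf of one tree with a leaf of another of
the same depth are proved by one induction on depth. Swaps at depth n let leaves cross the root at
depth n + 1. Tree independence at depth n + 1 then allows convenient trees to be chosen for swaps
there. -/
theorem avg_unique_and_exchange (M : MidpointAlgebra A) (h : I → A) (n : ℕ) :
    (∀ s a b, M.Avg h n s a → M.Avg h n s b → a = b) ∧
    (∀ x y s t a b a' b', M.Avg h n (x ::ₘ s) a → M.Avg h n (y ::ₘ t) b →
      M.Avg h n (y ::ₘ s) a' → M.Avg h n (x ::ₘ t) b' → M.m a b = M.m a' b') := by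
  classical
  induction n with
  | zero =>
    have key : ∀ {s : Multiset I} {a : A}, M.Avg h 0 s a → ∀ i, i ∈ s → a = h i := by
      intro s a H i hi
      cases H with
      | leaf j => rw [Multiset.mem_singleton.1 hi]
    refine ⟨fun s a b ha hb => ?_, fun x y s t a b a' b' ha hb ha' hb' => ?_⟩
    · obtain ⟨i, rfl⟩ := Multiset.card_eq_one.1 (by simpa using ha.card)
      rw [key ha i (by simp), key hb i (by simp)]
    · rw [key ha x (by simp), key hb y (by simp), key ha' y (by simp), key hb' x (by simp), M.comm]
  | succ n ih =>
    obtain ⟨ihu, ihx⟩ := ih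
    -- Exchange the blocks `q` and `r` across the root, one pair of elements at a time; the two
    -- blocks have equal size by the leaf counts.
    have split : ∀ q p r w a b a' b', M.Avg h n (p + q) a → M.Avg h n (r + w) b →
        M.Avg h n (p + r) a' → M.Avg h n (q + w) b' → M.m a b = M.m a' b' := by
      intro q
      induction q using Multiset.induction with
      | empty =>
        intro p r w a b a' b' ha hb ha' hb'
        have hr : r = 0 := by
          have h1 := ha.card
          have h2 := ha'.card
          rw [Multiset.card_add] at h1 h2
          rw [← Multiset.card_eq_zero]
          simp at h1
          omega
        subst hr
        rw [ihu _ _ _ ha ha', ihu _ _ _ hb hb']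
      | cons x q ihq =>
        intro p r w a b a' b' ha hb ha' hb'
        have h1 := ha.card
        have h2 := ha'.card
        rw [Multiset.card_add] at h1 h2
        rw [Multiset.card_cons] at h1
        obtain ⟨y, hy⟩ := Multiset.card_pos_iff_exists_mem.1 (show 0 < r.card by omega)
        obtain ⟨r, rfl⟩ := Multiset.exists_cons_of_mem hy
        rw [Multiset.add_cons] at ha ha'
        rw [Multiset.cons_add] at hb hb'
        have c1 := ha.card
        have c2 := hb.card
        obtain ⟨c, hc⟩ := M.exists_avg h n (y ::ₘ (p + q)) (by simpa using c1)
        obtain ⟨d, hd⟩ := M.exists_avg h n (x ::ₘ (r + w)) (by simpa using c2)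
        rw [ihx _ _ _ _ _ _ _ _ ha hb hc hd]
        refine ihq (y ::ₘ p) r (x ::ₘ w) _ _ _ _ ?_ ?_ ?_ ?_
        · rwa [Multiset.cons_add]
        · rwa [Multiset.add_cons]
        · rwa [Multiset.cons_add]
        · rwa [Multiset.add_cons]
    have hu : ∀ s a b, M.Avg h (n + 1) s a → M.Avg h (n + 1) s b → a = b := by
      intro s a b ha hb
      generalize hs' : s = s' at hb
      cases ha with
      | @node _ s₁ s₂ a₁ a₂ h₁ h₂ =>
        cases hb with
        | @node _ t₁ t₂ b₁ b₂ k₁ k₂ =>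
          have hcount : ∀ x, s₁.count x + s₂.count x = t₁.count x + t₂.count x := fun x => by
            rw [← Multiset.count_add, hs', Multiset.count_add]
          -- Both decompositions of the multiset refine to four blocks: the common left part, the
          -- common right part, and the two differences, which trade places.
          have e₁ : s₁ = (s₁ ∩ t₁) + (s₁ - t₁) := by
            ext x
            simp only [Multiset.count_add, Multiset.count_inter, Multiset.count_sub]
            omega
          have e₂ : s₂ = (t₁ - s₁) + (s₂ ∩ t₂) := by
            ext x
            have := hcount x
            simp only [Multiset.count_add, Multiset.count_inter, Multiset.count_sub]
            omega
          have e₃ : t₁ = (s₁ ∩ t₁) + (t₁ - s₁) := by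
            ext x
            simp only [Multiset.count_add, Multiset.count_inter, Multiset.count_sub]
            omega
          have e₄ : t₂ = (s₁ - t₁) + (s₂ ∩ t₂) := by
            ext x
            have := hcount x
            simp only [Multiset.count_add, Multiset.count_inter, Multiset.count_sub]
            omega
          exact split _ _ _ _ _ _ _ _ (e₁ ▸ h₁) (e₂ ▸ h₂) (e₃ ▸ k₁) (e₄ ▸ k₂)
    refine ⟨hu, fun x y s t a b a' b' ha hb ha' hb' => ?_⟩
    have hpos : 0 < 2 ^ n := by positivity
    have c1 := ha.card
    have c2 := hb.card
    rw [Multiset.card_cons, pow_succ] at c1 c2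
    -- By tree independence `x` and `y` may be assumed to lie in the left subtrees. The interchange
    -- law then puts these two subtrees side by side, where the inductive exchange applies.
    obtain ⟨s₁, s₂, rfl, hs₁⟩ := exists_add_of_le_card s (2 ^ n - 1) (by omega)
    obtain ⟨t₁, t₂, rfl, ht₁⟩ := exists_add_of_le_card t (2 ^ n - 1) (by omega)
    rw [Multiset.card_add] at c1 c2
    obtain ⟨a₁, ha₁⟩ := M.exists_avg h n (x ::ₘ s₁) (by rw [Multiset.card_cons]; omega)
    obtain ⟨a₁', ha₁'⟩ := M.exists_avg h n (y ::ₘ s₁) (by rw [Multiset.card_cons]; omega)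
    obtain ⟨a₂, ha₂⟩ := M.exists_avg h n s₂ (by omega)
    obtain ⟨b₁, hb₁⟩ := M.exists_avg h n (y ::ₘ t₁) (by rw [Multiset.card_cons]; omega)
    obtain ⟨b₁', hb₁'⟩ := M.exists_avg h n (x ::ₘ t₁) (by rw [Multiset.card_cons]; omega)
    obtain ⟨b₂, hb₂⟩ := M.exists_avg h n t₂ (by omega)
    rw [← Multiset.cons_add] at ha hb ha' hb'
    rw [hu _ _ _ ha (.node ha₁ ha₂), hu _ _ _ hb (.node hb₁ hb₂), hu _ _ _ ha' (.node ha₁' ha₂),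
      hu _ _ _ hb' (.node hb₁' hb₂), M.interchange, M.interchange a₁',
      ihx _ _ _ _ _ _ _ _ ha₁ hb₁ ha₁' hb₁']

theorem Avg.unique {n : ℕ} {s : Multiset I} {a b : A} (ha : M.Avg h n s a) (hb : M.Avg h n s b) :
    a = b :=
  (M.avg_unique_and_exchange h n).1 s a b ha hb

/-- A tree of depth `m` is grafted onto every leaf. -/
theorem Avg.bind {J : Type*} {g : J → A} {m n : ℕ} {s : Multiset I} {a : A} (H : M.Avg h n s a)
    (φ : I → Multiset J) (hφ : ∀ i, M.Avg g m (φ i) (h i)) : M.Avg g (m + n) (s.bind φ) a := by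
  induction H with
  | leaf i => simpa using hφ i
  | node _ _ ihs iht =>
    rw [Multiset.add_bind]
    exact .node ihs iht

theorem Avg.replicate (M : MidpointAlgebra A) (h : I → A) (k : ℕ) (i : I) :
    M.Avg h k (Multiset.replicate (2 ^ k) i) (h i) := by
  induction k with
  | zero => simpa [Multiset.replicate_one] using Avg.leaf i
  | succ k ih =>
    have := Avg.node ih ih
    rwa [M.idem, ← Multiset.replicate_add, ← mul_two, ← pow_succ] at this

theorem bind_replicate_eq_nsmul (s : Multiset I) (r : ℕ) :
    (s.bind fun i => Multiset.replicate r i) = r • s := by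
  induction s using Multiset.induction with
  | empty => simp
  | cons i s ih =>
    rw [Multiset.cons_bind, ih, ← Multiset.singleton_add, nsmul_add, Multiset.nsmul_singleton]

theorem Avg.nsmul {n : ℕ} {s : Multiset I} {a : A} (H : M.Avg h n s a) (k : ℕ) :
    M.Avg h (k + n) (2 ^ k • s) a := by
  rw [← bind_replicate_eq_nsmul]
  exact H.bind _ fun i => Avg.replicate M h k i

theorem Avg.map {J : Type*} (g : J → A) (e : I → J) (he : ∀ i, g (e i) = h i) {n : ℕ}
    {s : Multiset I} {a : A} (H : M.Avg h n s a) : M.Avg g n (s.map e) a := by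
  induction H with
  | leaf i => simpa [he] using Avg.leaf (M := M) (h := g) (e i)
  | node _ _ ihs iht =>
    rw [Multiset.map_add]
    exact .node ihs iht

theorem Avg.hom {B : Type*} {N : MidpointAlgebra B} (φ : A → B)
    (hφ : ∀ a b, φ (M.m a b) = N.m (φ a) (φ b)) {n : ℕ} {s : Multiset I} {a : A}
    (H : M.Avg h n s a) : N.Avg (fun i => φ (h i)) n s (φ a) := by
  induction H with
  | leaf i => exact .leaf i
  | node _ _ ihs iht =>
    rw [hφ]
    exact .node ihs iht

/-! ### Infinite iteration -/

theorem IsIterable.exists_seq (hM : M.IsIterable) (c : ℕ → A) :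
    ∃ t : ℕ → A, ∀ n, t n = M.m (t (n + 1)) (c n) := by
  obtain ⟨t, ht, -⟩ := hM (ULift ℕ) fun n => (⟨n.down + 1⟩, c n.down)
  exact ⟨fun n => t ⟨n⟩, fun n => ht ⟨n⟩⟩

/-- The recursion has no initial condition. Two elements can thus be proved equal by unfolding both
forever with the same coefficients. -/
theorem IsIterable.seq_unique (hM : M.IsIterable) {c t t' : ℕ → A}
    (ht : ∀ n, t n = M.m (t (n + 1)) (c n)) (ht' : ∀ n, t' n = M.m (t' (n + 1)) (c n)) (n : ℕ) :
    t n = t' n := by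
  have := (hM (ULift ℕ) fun n => (⟨n.down + 1⟩, c n.down)).unique
    (y₁ := fun n => t n.down) (y₂ := fun n => t' n.down) (fun n => ht n.down) fun n => ht' n.down
  exact congrFun this ⟨n⟩

end MidpointAlgebra

/-! ### The midpoint algebra of probability distributions -/

namespace PMF

variable {X : Type*} {Y : Type u} {Z : Type*}

/-- The midpoint `(p + q) / 2` of two distributions. -/
noncomputable def mid (p q : PMF Y) : PMF Y :=
  ⟨fun y => 2⁻¹ * (p y + q y), by
    have : ∑' y, 2⁻¹ * (p y + q y) = 1 := by
      rw [ENNReal.tsum_mul_left, ENNReal.tsum_add, p.tsum_coe, q.tsum_coe, one_add_one_eq_two]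
      exact ENNReal.inv_mul_cancel two_ne_zero ENNReal.ofNat_ne_top
    exact this ▸ ENNReal.summable.hasSum⟩

theorem mid_apply (p q : PMF Y) (y : Y) : mid p q y = 2⁻¹ * (p y + q y) := rfl

theorem two_mul_mid_apply (p q : PMF Y) (y : Y) : 2 * mid p q y = p y + q y := by
  rw [mid_apply, ← mul_assoc, ENNReal.mul_inv_cancel two_ne_zero ENNReal.ofNat_ne_top, one_mul]

theorem eq_mid_iff {p q r : PMF Y} : r = mid p q ↔ ∀ y, 2 * r y = p y + q y := by
  refine ⟨?_, fun h => PMF.ext fun y => ?_⟩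
  · rintro rfl y
    exact two_mul_mid_apply p q y
  · simp_rw [← two_mul_mid_apply] at h
    exact (ENNReal.mul_right_inj two_ne_zero ENNReal.ofNat_ne_top).1 (h y)

theorem mid_right_injective (d : PMF Y) {q q' : PMF Y} (h : mid q d = mid q' d) : q = q' := by
  refine PMF.ext fun y => ?_
  have := two_mul_mid_apply q d y
  rw [h, two_mul_mid_apply] at this
  exact ((ENNReal.add_left_inj (d.apply_ne_top y)).1 this).symm

theorem mid_toReal (p q : PMF Y) (y : Y) :
    2 * (mid p q y).toReal = (p y).toReal + (q y).toReal := by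
  rw [← ENNReal.toReal_add (p.apply_ne_top y) (q.apply_ne_top y), ← two_mul_mid_apply,
    ENNReal.toReal_mul, ENNReal.toReal_ofNat]

theorem mid_bind (p q : PMF X) (k : X → PMF Y) : (mid p q).bind k = mid (p.bind k) (q.bind k) := by
  refine PMF.ext fun y => ?_
  simp only [bind_apply, mid_apply]
  rw [← ENNReal.tsum_add, ← ENNReal.tsum_mul_left]
  exact tsum_congr fun x => by ring

theorem bind_mid (p : PMF X) (k l : X → PMF Y) :
    (p.bind fun x => mid (k x) (l x)) = mid (p.bind k) (p.bind l) := by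
  refine PMF.ext fun y => ?_
  simp only [bind_apply, mid_apply]
  rw [← ENNReal.tsum_add, ← ENNReal.tsum_mul_left]
  exact tsum_congr fun x => by ring

variable (Y) in
/-- The midpoint algebra of all distributions on `Y`. -/
noncomputable def midpointAlgebra : MidpointAlgebra (PMF Y) where
  m := mid
  idem p := (eq_mid_iff.2 fun y => two_mul (p y)).symm
  comm p q := PMF.ext fun y => by simp only [mid_apply, add_comm]
  interchange a b c d := PMF.ext fun y => by
    simp only [mid_apply]
    ring

/-- The other half is 2p − d, of total mass 2 − 1 = 1. -/
theorem exists_eq_mid {p d : PMF Y} (h : ∀ y, d y ≤ 2 * p y) : ∃ q, p = mid q d := by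
  have hs : ∑' y, (2 * p y - d y) = 1 := by
    have h₁ : ∑' y, (2 * p y - d y) + ∑' y, d y = 2 := by
      rw [← ENNReal.tsum_add]
      simp_rw [tsub_add_cancel_of_le (h _)]
      rw [ENNReal.tsum_mul_left, p.tsum_coe, mul_one]
    rw [d.tsum_coe, show (2 : ENNReal) = 1 + 1 from one_add_one_eq_two.symm] at h₁
    rw [show (2 : ENNReal) = 1 + 1 from one_add_one_eq_two.symm]
    exact (ENNReal.add_left_inj ENNReal.one_ne_top).1 h₁
  refine ⟨⟨fun y => 2 * p y - d y, hs ▸ ENNReal.summable.hasSum⟩, eq_mid_iff.2 fun y => ?_⟩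
  exact (tsub_add_cancel_of_le (h y)).symm

theorem avg_toReal {I : Type*} {h : I → PMF Y} {n : ℕ} {s : Multiset I} {p : PMF Y}
    (H : (midpointAlgebra Y).Avg h n s p) (y : Y) :
    2 ^ n * (p y).toReal = (s.map fun i => (h i y).toReal).sum := by
  induction H with
  | leaf i => simp
  | @node n s t p q _ _ ihs iht =>
    rw [Multiset.map_add, Multiset.sum_add, ← ihs, ← iht, pow_succ, mul_assoc, ← mul_add]
    congr 1
    exact mid_toReal p q y

theorem avg_pure_toReal [DecidableEq Y] {n : ℕ} {s : Multiset Y} {p : PMF Y}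
    (H : (midpointAlgebra Y).Avg pure n s p) (y : Y) : 2 ^ n * (p y).toReal = s.count y := by
  rw [avg_toReal H]
  clear H
  induction s using Multiset.induction with
  | empty => simp
  | cons x s ih =>
    rw [Multiset.map_cons, Multiset.sum_cons, ih, Multiset.count_cons, PMF.pure_apply]
    split_ifs <;> simp [add_comm]

/-- Twice a distribution strictly dominates a finitely supported dyadic distribution. -/
theorem exists_dyadic_lt (p : PMF Y) : ∃ (k : ℕ) (t : Multiset Y) (d : PMF Y),
    (midpointAlgebra Y).Avg pure k t d ∧ (∀ y ∈ t, d y < 2 * p y) ∧ ∀ y, d y ≤ 2 * p y := by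
  classical
  have hsum : HasSum (fun y => (p y).toReal) 1 := by
    have := ENNReal.hasSum_toReal (f := p) (by rw [p.tsum_coe]; exact ENNReal.one_ne_top)
    rwa [← ENNReal.tsum_toReal_eq fun y => p.apply_ne_top y, p.tsum_coe, ENNReal.toReal_one] at this
  -- A finite set of mass above 1/2 makes twice its mass exceed 1; the excess pays for rounding
  -- down, which costs at most one unit of 2^(-k) per element of `F`.
  obtain ⟨F, hF⟩ := ((tendsto_order.1 hsum).1 (1 / 2) (by norm_num)).exists
  obtain ⟨k, hk⟩ := pow_unbounded_of_one_lt (F.card / (2 * ∑ y ∈ F, (p y).toReal - 1))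
    (one_lt_two (α := ℝ))
  rw [div_lt_iff₀ (by linarith)] at hk
  -- The largest natural number strictly below 2^k · 2p(y); truncated subtraction gives 0 when p(y)
  -- = 0.
  let c : Y → ℕ := fun y => ⌈2 ^ k * (2 * (p y).toReal)⌉₊ - 1
  let S : Multiset Y := ∑ y ∈ F, Multiset.replicate (c y) y
  have hcard : 2 ^ k ≤ S.card := by
    have h₁ : S.card = ∑ y ∈ F, c y := by simp [S]
    have h₂ : ∑ y ∈ F, (2 ^ k * (2 * (p y).toReal) - 1) ≤ ∑ y ∈ F, (c y : ℝ) := by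
      refine Finset.sum_le_sum fun y _ => ?_
      have := Nat.le_ceil (2 ^ k * (2 * (p y).toReal))
      have h₃ : (⌈2 ^ k * (2 * (p y).toReal)⌉₊ : ℝ) ≤ (c y : ℝ) + 1 := by
        have : ⌈2 ^ k * (2 * (p y).toReal)⌉₊ ≤ c y + 1 := by
          simp only [c]
          omega
        exact_mod_cast this
      linarith
    rw [Finset.sum_sub_distrib, ← Finset.mul_sum, ← Finset.mul_sum] at h₂
    simp only [Finset.sum_const, nsmul_eq_mul, mul_one] at h₂
    rw [h₁]
    have : (2 : ℝ) ^ k ≤ ∑ y ∈ F, (c y : ℝ) := by nlinarith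
    exact_mod_cast this
  -- Any 2^k elements of `S` will do: discarding the others only lowers the weights.
  obtain ⟨t, t', hS, ht⟩ := MidpointAlgebra.exists_add_of_le_card S _ hcard
  obtain ⟨d, hd⟩ := (midpointAlgebra Y).exists_avg pure k t ht
  have hlt : ∀ y ∈ t, d y < 2 * p y := by
    intro y hy
    have h₁ : 0 < t.count y := Multiset.count_pos.2 hy
    have h₂ : t.count y ≤ c y := by
      have h₃ : S.count y ≤ c y := by
        simp only [S, Multiset.count_sum', Multiset.count_replicate]
        rw [Finset.sum_ite_eq' F y]
        split_ifs <;> simp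
      rw [hS, Multiset.count_add] at h₃
      omega
    have h₃ : (t.count y : ℝ) < 2 ^ k * (2 * (p y).toReal) := by
      apply Nat.lt_ceil.1
      simp only [c] at h₂
      omega
    rw [← avg_pure_toReal hd] at h₃
    have h₄ := lt_of_mul_lt_mul_left h₃ (by positivity)
    have h₅ : (2 * p y).toReal = 2 * (p y).toReal := by
      rw [ENNReal.toReal_mul, ENNReal.toReal_ofNat]
    rw [← h₅] at h₄
    exact (ENNReal.toReal_lt_toReal (d.apply_ne_top y)
      (ENNReal.mul_ne_top ENNReal.ofNat_ne_top (p.apply_ne_top y))).1 h₄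
  refine ⟨k, t, d, hd, hlt, fun y => ?_⟩
  by_cases hy : y ∈ t
  · exact (hlt y hy).le
  · have h₁ := avg_pure_toReal hd y
    rw [Multiset.count_eq_zero_of_notMem hy, Nat.cast_zero, mul_eq_zero, ENNReal.toReal_eq_zero_iff]
      at h₁
    rcases h₁ with h₁ | h₁ | h₁
    · exact absurd h₁ (by positivity)
    · simp [h₁]
    · exact absurd h₁ (d.apply_ne_top y)

/-- The distributions form an iterable midpoint algebra. -/
theorem midpointAlgebra_isIterable : (midpointAlgebra Y).IsIterable := by
  intro X s
  let c : X → ℕ → PMF Y := fun x n => (s ((fun x => (s x).1)^[n] x)).2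
  have hg : ∑' n : ℕ, (2⁻¹ : ENNReal) ^ (n + 1) = 1 := by
    simp_rw [pow_succ]
    rw [ENNReal.tsum_mul_right, ENNReal.tsum_geometric, ENNReal.one_sub_inv_two, inv_inv]
    exact ENNReal.mul_inv_cancel two_ne_zero ENNReal.ofNat_ne_top
  have ht : ∀ x, ∑' y, ∑' n, (2⁻¹ : ENNReal) ^ (n + 1) * c x n y = 1 := fun x => by
    rw [ENNReal.tsum_comm]
    simp_rw [ENNReal.tsum_mul_left, PMF.tsum_coe, mul_one]
    exact hg
  -- The solution at `x` is the series of the distributions met along the orbit of `x`, with weights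
  -- 2^(-n-1).
  refine existsUnique_of_exists_of_unique ⟨fun x => ⟨fun y => ∑' n, (2⁻¹ : ENNReal) ^ (n + 1) * c x n y,
    ht x ▸ ENNReal.summable.hasSum⟩, fun x => PMF.ext fun y => ?_⟩ fun t t' ht ht' => ?_
  · change ∑' n, (2⁻¹ : ENNReal) ^ (n + 1) * c x n y =
      2⁻¹ * ((∑' n, (2⁻¹ : ENNReal) ^ (n + 1) * c (s x).1 n y) + (s x).2 y)
    rw [tsum_eq_zero_add' ENNReal.summable, mul_add, add_comm, ← ENNReal.tsum_mul_left]
    congr 1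
    · refine tsum_congr fun n => ?_
      rw [pow_succ' _ (n + 1), mul_assoc]
      rfl
    · simp [c]
  -- The difference of two solutions doubles at each step of the orbit but never exceeds 1.
  · have key : ∀ (n : ℕ) x y, 2 ^ n * |(t x y).toReal - (t' x y).toReal| ≤ 1 := by
      intro n
      induction n with
      | zero =>
        intro x y
        have bound : ∀ p : PMF Y, (p y).toReal ≤ 1 := fun p =>
          ENNReal.toReal_le_of_le_ofReal zero_le_one (by simpa using p.coe_le_one y)
        rw [pow_zero, one_mul, abs_le]
        constructor <;> linarith [bound (t x), bound (t' x),
          ENNReal.toReal_nonneg (a := t x y), ENNReal.toReal_nonneg (a := t' x y)]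
      | succ n ih =>
        intro x y
        have h₁ : 2 * ((t x y).toReal - (t' x y).toReal) =
            (t (s x).1 y).toReal - (t' (s x).1 y).toReal := by
          have h₂ : t x = mid (t (s x).1) (s x).2 := ht x
          have h₃ : t' x = mid (t' (s x).1) (s x).2 := ht' x
          have h₄ := mid_toReal (t (s x).1) (s x).2 y
          have h₅ := mid_toReal (t' (s x).1) (s x).2 y
          rw [← h₂] at h₄
          rw [← h₃] at h₅
          linarith
        have h₂ : 2 * |(t x y).toReal - (t' x y).toReal| =
            |(t (s x).1 y).toReal - (t' (s x).1 y).toReal| := by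
          rw [← h₁, abs_mul, abs_two]
        rw [pow_succ, mul_assoc, h₂]
        exact ih _ _
    refine funext fun x => PMF.ext fun y => ?_
    rw [← ENNReal.toReal_eq_toReal_iff' ((t x).apply_ne_top y) ((t' x).apply_ne_top y)]
    by_contra hne
    have hpos : 0 < |(t x y).toReal - (t' x y).toReal| := abs_pos.2 (sub_ne_zero.2 hne)
    obtain ⟨n, hn⟩ := pow_unbounded_of_one_lt (1 / |(t x y).toReal - (t' x y).toReal|)
      (one_lt_two (α := ℝ))
    rw [div_lt_iff₀ hpos] at hn
    exact absurd (key n x y) (not_le.2 hn)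

end PMF

/-! ### Distributions form the free iterable midpoint algebra -/

namespace MidpointAlgebra

variable {A : Type v} {Y : Type u} (M : MidpointAlgebra A) (f : Y → A)

/-- The product of the midpoint algebra of distributions on `Y` with `M`. -/
noncomputable abbrev graphAlgebra (Y : Type u) : MidpointAlgebra (PMF Y × A) :=
  (PMF.midpointAlgebra Y).prod M

/-- The generators of the graph of the extension of `f` to distributions. -/
noncomputable abbrev graphGen (y : Y) : PMF Y × A := (PMF.pure y, f y)

/-- Pairs that are infinite series `∑ 2 ^ (-n-1) c n` of dyadic averages of generators. -/
def IsDyadicSeries (x : PMF Y × A) : Prop :=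
  ∃ X c : ℕ → PMF Y × A, X 0 = x ∧ ∀ n, X n = (M.graphAlgebra Y).m (X (n + 1)) (c n) ∧
    ∃ k t, (M.graphAlgebra Y).Avg (graphGen f) k t (c n)

/-- Pairs that are dyadic averages of generators and one infinite series. -/
def IsDyadicPartialSeries (x : PMF Y × A) : Prop :=
  ∃ (n : ℕ) (s : Multiset (Option Y)) (z : PMF Y × A), M.IsDyadicSeries f z ∧
    (M.graphAlgebra Y).Avg (fun o => o.elim z (graphGen f)) n s x

variable {M f}

theorem IsDyadicSeries.partial {x : PMF Y × A} (hx : M.IsDyadicSeries f x) :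
    M.IsDyadicPartialSeries f x :=
  ⟨0, {none}, x, hx, Avg.leaf (h := fun o : Option Y => o.elim x (graphGen f)) none⟩

theorem IsDyadicSeries.pure (y : Y) : M.IsDyadicSeries f (graphGen f y) :=
  ⟨fun _ => graphGen f y, fun _ => graphGen f y, rfl, fun _ =>
    ⟨((M.graphAlgebra Y).idem _).symm, 0, {y}, .leaf y⟩⟩

theorem IsDyadicSeries.mid {x x' : PMF Y × A} (hx : M.IsDyadicSeries f x)
    (hx' : M.IsDyadicSeries f x') : M.IsDyadicSeries f ((M.graphAlgebra Y).m x x') := by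
  obtain ⟨X, c, rfl, h⟩ := hx
  obtain ⟨X', c', rfl, h'⟩ := hx'
  refine ⟨fun n => (M.graphAlgebra Y).m (X n) (X' n), fun n => (M.graphAlgebra Y).m (c n) (c' n),
    rfl, fun n => ?_⟩
  obtain ⟨h₁, k, t, H⟩ := h n
  obtain ⟨h₁', k', t', H'⟩ := h' n
  -- The two averages are first brought to the common depth `k + k'`.
  refine ⟨?_, _, _, .node (H.nsmul k') (add_comm k k' ▸ H'.nsmul k)⟩
  simp only
  rw [h₁, h₁', interchange]

/-- Dyadic parts are split off `p` forever, and iterability of `M` sums the matching averages in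
`A`. Pairs in `PMF Y × A` keep track of the weights and of the value at once. -/
theorem exists_isDyadicSeries (hM : M.IsIterable) (f : Y → A) (p : PMF Y) :
    ∃ a, M.IsDyadicSeries f (p, a) := by
  have key : ∀ p : PMF Y, ∃ (q : PMF Y) (c : PMF Y × A), p = PMF.mid q c.1 ∧
      ∃ k t, (M.graphAlgebra Y).Avg (graphGen f) k t c := by
    intro p
    obtain ⟨k, t, d, hd, -, hle⟩ := p.exists_dyadic_lt
    obtain ⟨q, hq⟩ := PMF.exists_eq_mid hle
    obtain ⟨c, hc⟩ := (M.graphAlgebra Y).exists_avg (graphGen f) k t hd.card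
    have : c.1 = d := (hc.hom (N := PMF.midpointAlgebra Y) Prod.fst fun _ _ => rfl).unique hd
    exact ⟨q, c, this ▸ hq, k, t, hc⟩
  choose next c h₁ h₂ using key
  let q : ℕ → PMF Y := fun n => next^[n] p
  obtain ⟨a, ha⟩ := hM.exists_seq fun n => (c (q n)).2
  refine ⟨a 0, fun n => (q n, a n), fun n => c (q n), rfl, fun n => ⟨?_, h₂ _⟩⟩
  refine Prod.ext ?_ (ha n)
  change q n = PMF.mid (next^[n + 1] p) _
  rw [Function.iterate_succ_apply']
  exact h₁ _

/-- Unfolding one term of the series halves the share of the leaves carrying the remainder `z`,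
which are labelled `none`. -/
theorem IsDyadicPartialSeries.exists_small {x : PMF Y × A} (hx : M.IsDyadicPartialSeries f x)
    [DecidableEq Y] (N : ℕ) : ∃ (n : ℕ) (s : Multiset (Option Y)) (z : PMF Y × A),
      M.IsDyadicSeries f z ∧ (M.graphAlgebra Y).Avg (fun o => o.elim z (graphGen f)) n s x ∧
        2 ^ N * s.count none ≤ 2 ^ n := by
  induction N with
  | zero =>
    obtain ⟨n, s, z, hz, hs⟩ := hx
    refine ⟨n, s, z, hz, hs, ?_⟩
    rw [pow_zero, one_mul, ← hs.card]
    exact Multiset.count_le_card _ _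
  | succ N ih =>
    obtain ⟨n, s, z, ⟨X, c, rfl, hX⟩, hs, hN⟩ := ih
    obtain ⟨h₀, k, t, ht⟩ := hX 0
    have hX₁ : M.IsDyadicSeries f (X 1) :=
      ⟨fun n => X (n + 1), fun n => c (n + 1), rfl, fun n => hX (n + 1)⟩
    let g' : Option Y → PMF Y × A := fun o => o.elim (X 1) (graphGen f)
    -- The old remainder becomes half new remainder and half the dyadic term `c 0`; a generator is
    -- merely repeated to reach the same depth.
    let φ : Option Y → Multiset (Option Y) := fun o =>
      o.elim (Multiset.replicate (2 ^ k) none + t.map some)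
        fun y => Multiset.replicate (2 ^ (k + 1)) (some y)
    have hφ : ∀ o, (M.graphAlgebra Y).Avg g' (k + 1) (φ o) (o.elim (X 0) (graphGen f)) := by
      rintro (_ | y)
      · change (M.graphAlgebra Y).Avg g' (k + 1) _ (X 0)
        rw [h₀]
        exact .node (Avg.replicate _ g' k none) (ht.map g' some fun _ => rfl)
      · exact Avg.replicate _ g' (k + 1) (some y)
    refine ⟨_, _, X 1, hX₁, hs.bind φ hφ, ?_⟩
    have hcount : (s.bind φ).count none = 2 ^ k * s.count none := by
      clear hs hN
      induction s using Multiset.induction with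
      | empty => simp
      | cons o s ih =>
        rw [Multiset.cons_bind, Multiset.count_add, ih]
        cases o with
        | none =>
          simp [φ, mul_add, add_comm]
        | some y => simp [φ, Multiset.count_replicate]
    rw [hcount, pow_add _ (k + 1), pow_succ 2 k, pow_succ 2 N]
    calc 2 ^ N * 2 * (2 ^ k * s.count none) = 2 ^ k * 2 * (2 ^ N * s.count none) := by ring
      _ ≤ 2 ^ k * 2 * 2 ^ n := Nat.mul_le_mul_left _ hN

/-- Once the remainder has a small enough share, the generators alone contain half a tree's worth of
leaves computing `c`. Strictness of the bound leaves room for that share, which is still positive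
after finitely many unfoldings. -/
theorem IsDyadicPartialSeries.exists_split {x c : PMF Y × A} (hx : M.IsDyadicPartialSeries f x)
    {k : ℕ} {t : Multiset Y} (hc : (M.graphAlgebra Y).Avg (graphGen f) k t c)
    (hlt : ∀ y ∈ t, c.1 y < 2 * x.1 y) :
    ∃ x', M.IsDyadicPartialSeries f x' ∧ x = (M.graphAlgebra Y).m x' c := by
  classical
  have hlt' : ∀ y ∈ t, 0 < 2 * (x.1 y).toReal - (c.1 y).toReal := by
    intro y hy
    have := (ENNReal.toReal_lt_toReal (c.1.apply_ne_top y)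
      (ENNReal.mul_ne_top ENNReal.ofNat_ne_top (x.1.apply_ne_top y))).2 (hlt y hy)
    rw [ENNReal.toReal_mul, ENNReal.toReal_ofNat] at this
    linarith
  -- A remainder of share 2^(-N) contributes at most 2 · 2^(-N) to 2x(y), hence the constant 2.
  obtain ⟨N, hN⟩ : ∃ N : ℕ, ∀ y ∈ t, 2 < 2 ^ N * (2 * (x.1 y).toReal - (c.1 y).toReal) := by
    have : ∀ᶠ N : ℕ in Filter.atTop, ∀ y ∈ t.toFinset,
        2 < (2 : ℝ) ^ N * (2 * (x.1 y).toReal - (c.1 y).toReal) := by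
      rw [Filter.eventually_all_finset]
      intro y hy
      exact ((tendsto_pow_atTop_atTop_of_one_lt one_lt_two).atTop_mul_const
        (hlt' y (Multiset.mem_toFinset.1 hy))).eventually_gt_atTop 2
    obtain ⟨N, hN⟩ := this.exists
    exact ⟨N, fun y hy => hN y (Multiset.mem_toFinset.2 hy)⟩
  obtain ⟨n, s, z, hz, hs, hsN⟩ := hx.exists_small N
  -- At depth `k + 1 + n` the copies of `t` fill exactly half of the leaves. The complement `u` is
  -- the other half, so tree independence lets `c` be one child of the root.
  have hle : 2 ^ n • t.map some ≤ 2 ^ (k + 1) • s := by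
    rw [Multiset.le_iff_count]
    rintro (_ | y)
    · simp
    · rw [Multiset.count_nsmul, Multiset.count_nsmul,
        Multiset.count_map_eq_count' _ _ (Option.some_injective Y)]
      by_cases hy : y ∈ t
      swap
      · simp [Multiset.count_eq_zero_of_notMem hy]
      have w₁ : 2 ^ k * (c.1 y).toReal = t.count y :=
        PMF.avg_pure_toReal (hc.hom (N := PMF.midpointAlgebra Y) Prod.fst fun _ _ => rfl) y
      have w₂ : 2 ^ n * (x.1 y).toReal ≤ s.count (some y) + s.count none := by
        rw [PMF.avg_toReal (hs.hom (N := PMF.midpointAlgebra Y) Prod.fst fun _ _ => rfl) y]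
        clear hs hsN
        induction s using Multiset.induction with
        | empty => simp
        | cons o s ih =>
          rw [Multiset.map_cons, Multiset.sum_cons]
          refine (add_le_add le_rfl ih).trans ?_
          cases o with
          | none =>
            have : (z.1 y).toReal ≤ 1 :=
              ENNReal.toReal_le_of_le_ofReal zero_le_one (by simpa using z.1.coe_le_one y)
            simp only [Option.elim, Multiset.count_cons_self, Multiset.count_cons_of_ne, ne_eq,
              reduceCtorEq, not_false_eq_true, Nat.cast_add, Nat.cast_one]
            linarith
          | some y' =>
            have : ((some y' ::ₘ s).count none) = s.count none := by simp
            rw [this]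
            simp only [Option.elim, PMF.pure_apply, Multiset.count_cons, Option.some.injEq]
            split_ifs <;> simp <;> linarith
      have w₃ : (2 : ℝ) ^ N * s.count none ≤ 2 ^ n := by exact_mod_cast hsN
      have w₄ := hN y hy
      have hNpos : (0 : ℝ) < 2 ^ N := by positivity
      have hkpos : (0 : ℝ) < 2 ^ k := by positivity
      have hnpos : (0 : ℝ) < 2 ^ n := by positivity
      have w₅ : 2 * (s.count none : ℝ) ≤ 2 ^ n * (2 * (x.1 y).toReal - (c.1 y).toReal) := by
        have : (2 : ℝ) ^ N * (2 * s.count none) ≤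
            2 ^ N * (2 ^ n * (2 * (x.1 y).toReal - (c.1 y).toReal)) := by nlinarith
        exact le_of_mul_le_mul_left this hNpos
      have w₆ : (2 : ℝ) ^ n * (c.1 y).toReal ≤ 2 * s.count (some y) := by nlinarith
      have w₇ : (2 : ℝ) ^ n * t.count y ≤ 2 ^ (k + 1) * s.count (some y) := by
        rw [← w₁, pow_succ]
        nlinarith
      exact_mod_cast w₇
  obtain ⟨u, hu⟩ := Multiset.le_iff_exists_add.1 hle
  have hs' := hs.nsmul (k + 1)
  have ht' := (hc.map (fun o => o.elim z (graphGen f)) some fun _ => rfl).nsmul n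
  have hcard := hs'.card
  rw [hu, Multiset.card_add, ht'.card, show k + 1 + n = n + k + 1 by omega, pow_succ] at hcard
  obtain ⟨x', hx'⟩ := (M.graphAlgebra Y).exists_avg (fun o => o.elim z (graphGen f)) (n + k) u
    (by omega)
  refine ⟨x', ⟨_, _, z, hz, hx'⟩, ?_⟩
  rw [hu, add_comm _ u, show k + 1 + n = n + k + 1 by omega] at hs'
  exact hs'.unique (.node hx' ht')

/-- `T` consists of pairs of values over one distribution. Splitting the same `c` off both keeps the
pair in `T`, since cancelling `c.1` leaves the same distribution on both sides. -/
theorem IsDyadicPartialSeries.unique (hM : M.IsIterable) {p : PMF Y} {a b : A}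
    (ha : M.IsDyadicPartialSeries f (p, a)) (hb : M.IsDyadicPartialSeries f (p, b)) : a = b := by
  let T := { x : PMF Y × A × A //
    M.IsDyadicPartialSeries f (x.1, x.2.1) ∧ M.IsDyadicPartialSeries f (x.1, x.2.2) }
  have key : ∀ x : T, ∃ (x' : T) (c : A), x.1.2.1 = M.m x'.1.2.1 c ∧
      x.1.2.2 = M.m x'.1.2.2 c := by
    rintro ⟨⟨p, a, b⟩, ha, hb⟩
    obtain ⟨k, t, d, hd, hlt, -⟩ := p.exists_dyadic_lt
    obtain ⟨c, hc⟩ := (M.graphAlgebra Y).exists_avg (graphGen f) k t hd.card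
    obtain rfl : c.1 = d := (hc.hom (N := PMF.midpointAlgebra Y) Prod.fst fun _ _ => rfl).unique hd
    obtain ⟨⟨p₁, a'⟩, ha', hpa⟩ := ha.exists_split hc hlt
    obtain ⟨⟨p₂, b'⟩, hb', hpb⟩ := hb.exists_split hc hlt
    obtain rfl : p₁ = p₂ := PMF.mid_right_injective c.1
      ((congrArg Prod.fst hpa).symm.trans (congrArg Prod.fst hpb))
    exact ⟨⟨(p₁, a', b'), ha', hb'⟩, c.2, congrArg Prod.snd hpa, congrArg Prod.snd hpb⟩
  choose next c h₁ h₂ using key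
  let x : ℕ → T := fun n => next^[n] ⟨(p, a, b), ha, hb⟩
  have hx : ∀ n, x (n + 1) = next (x n) := fun n => Function.iterate_succ_apply' _ _ _
  exact hM.seq_unique (t := fun n => (x n).1.2.1) (t' := fun n => (x n).1.2.2)
    (c := fun n => c (x n)) (fun n => by rw [hx]; exact h₁ _) (fun n => by rw [hx]; exact h₂ _) 0

/-- The extension of `f : Y → A` to a midpoint homomorphism on distributions. -/
noncomputable def IsIterable.lift (hM : M.IsIterable) (f : Y → A) (p : PMF Y) : A :=
  (exists_isDyadicSeries hM f p).choose

theorem IsIterable.lift_eq (hM : M.IsIterable) {p : PMF Y} {a : A}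
    (h : M.IsDyadicSeries f (p, a)) : hM.lift f p = a :=
  (exists_isDyadicSeries hM f p).choose_spec.partial.unique hM h.partial

@[simp]
theorem IsIterable.lift_pure (hM : M.IsIterable) (y : Y) : hM.lift f (PMF.pure y) = f y :=
  hM.lift_eq (.pure y)

theorem IsIterable.lift_mid (hM : M.IsIterable) (p q : PMF Y) :
    hM.lift f (PMF.mid p q) = M.m (hM.lift f p) (hM.lift f q) :=
  hM.lift_eq ((exists_isDyadicSeries hM f p).choose_spec.mid
    (exists_isDyadicSeries hM f q).choose_spec)

/-- Midpoint homomorphisms from distributions to an iterable midpoint algebra are determined by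
their values on Dirac distributions. -/
theorem IsIterable.hom_ext (hM : M.IsIterable) {φ ψ : PMF Y → A}
    (hφ : ∀ p q, φ (PMF.mid p q) = M.m (φ p) (φ q)) (hψ : ∀ p q, ψ (PMF.mid p q) = M.m (ψ p) (ψ q))
    (h : ∀ y, φ (PMF.pure y) = ψ (PMF.pure y)) (p : PMF Y) : φ p = ψ p := by
  -- On a finite dyadic average both homomorphisms are computed from the values at Dirac
  -- distributions; only the rest `q` still has to be compared.
  have key : ∀ p : PMF Y, ∃ (q : PMF Y) (d : PMF Y), p = PMF.mid q d ∧ φ d = ψ d := by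
    intro p
    obtain ⟨k, t, d, hd, -, hle⟩ := p.exists_dyadic_lt
    obtain ⟨q, hq⟩ := PMF.exists_eq_mid hle
    refine ⟨q, d, hq, ?_⟩
    have h₁ := hd.hom φ hφ
    have h₂ := hd.hom ψ hψ
    simp only [h] at h₁
    exact h₁.unique h₂
  choose next d h₁ h₂ using key
  let q : ℕ → PMF Y := fun n => next^[n] p
  have hq : ∀ n, q (n + 1) = next (q n) := fun n => Function.iterate_succ_apply' _ _ _
  refine hM.seq_unique (t := fun n => φ (q n)) (t' := fun n => ψ (q n))
    (c := fun n => φ (d (q n))) (fun n => ?_) (fun n => ?_) 0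
  · rw [hq, ← hφ, ← h₁]
  · rw [hq, h₂, ← hψ, ← h₁]

end MidpointAlgebra

/-! ### Coproducts as a property of families of morphisms -/

section IsCoprod

variable {C : Type u₁} [Category.{v₁} C] {D : Type u₂} [Category.{v₂} D]

/-- The morphisms `i j` exhibit `P` as a coproduct of the objects `X j`. -/
def IsCoprod {J : Type u} {X : J → C} {P : C} (i : ∀ j, X j ⟶ P) : Prop :=
  ∀ (Z : C) (g : ∀ j, X j ⟶ Z), ∃! h : P ⟶ Z, ∀ j, i j ≫ h = g j

namespace IsCoprod

variable {J : Type u} {X : J → C} {P : C} {i : ∀ j, X j ⟶ P}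

/-- The morphism out of a coproduct with the given components. -/
noncomputable def desc (h : IsCoprod i) {Z : C} (g : ∀ j, X j ⟶ Z) : P ⟶ Z := (h Z g).choose

@[simp]
theorem fac (h : IsCoprod i) {Z : C} (g : ∀ j, X j ⟶ Z) (j : J) : i j ≫ h.desc g = g j :=
  (h Z g).choose_spec.1 j

@[simp]
theorem fac_assoc (h : IsCoprod i) {Z W : C} (g : ∀ j, X j ⟶ Z) (j : J) (k : Z ⟶ W) :
    i j ≫ h.desc g ≫ k = g j ≫ k := by
  rw [← Category.assoc, h.fac]

theorem hom_ext (h : IsCoprod i) {Z : C} {f g : P ⟶ Z} (w : ∀ j, i j ≫ f = i j ≫ g) : f = g :=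
  (h Z fun j => i j ≫ g).unique w fun _ => rfl

/-- The colimit cocone of a coproduct. -/
noncomputable def isColimit (h : IsCoprod i) : IsColimit (Cofan.mk P i) :=
  Cofan.IsColimit.mk _ (fun t => h.desc t.inj) (fun t j => h.fac t.inj j) fun t _ hm =>
    h.hom_ext fun j => (hm j).trans (h.fac t.inj j).symm

theorem of_isColimit (h : IsColimit (Cofan.mk P i)) : IsCoprod i := fun Z g =>
  ⟨Cofan.IsColimit.desc h g, fun j => Cofan.IsColimit.fac h g j, fun _ hm =>
    Cofan.IsColimit.hom_ext h _ _ fun j => (hm j).trans (Cofan.IsColimit.fac h g j).symm⟩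

theorem map (h : IsCoprod i) (G : C ⥤ D) [PreservesColimitsOfShape (Discrete J) G] :
    IsCoprod fun j => G.map (i j) :=
  of_isColimit (isColimitCofanMkObjOfIsColimit G X i h.isColimit)

theorem iso_comp (h : IsCoprod i) {Y : J → C} (e : ∀ j, Y j ≅ X j) :
    IsCoprod fun j => (e j).hom ≫ i j :=
  fun _ g => ⟨h.desc fun j => (e j).inv ≫ g j, fun j => by simp, fun m hm => h.hom_ext fun j => by
    rw [h.fac, ← hm j, Category.assoc, Iso.inv_hom_id_assoc]⟩

theorem exists_of_hasColimitsOfShape [HasColimitsOfShape (Discrete J) C] (X : J → C) :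
    ∃ (P : C) (i : ∀ j, X j ⟶ P), IsCoprod i :=
  ⟨∐ X, Sigma.ι X, of_isColimit (coproductIsCoproduct X)⟩

theorem hasColimitsOfShape (H : ∀ X : J → C, ∃ (P : C) (i : ∀ j, X j ⟶ P), IsCoprod i) :
    HasColimitsOfShape (Discrete J) C where
  has_colimit K := by
    obtain ⟨P, i, h⟩ := H (K.obj ∘ Discrete.mk)
    have : HasColimit (Discrete.functor (K.obj ∘ Discrete.mk)) := ⟨⟨_, h.isColimit⟩⟩
    exact hasColimit_of_iso Discrete.natIsoFunctor

theorem preservesColimitsOfShape (G : C ⥤ D)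
    (H : ∀ X : J → C, ∃ (P : C) (i : ∀ j, X j ⟶ P), IsCoprod i ∧ IsCoprod fun j => G.map (i j)) :
    PreservesColimitsOfShape (Discrete J) G where
  preservesColimit {K} := by
    obtain ⟨P, i, h, h'⟩ := H (K.obj ∘ Discrete.mk)
    have : PreservesColimit (Discrete.functor (K.obj ∘ Discrete.mk)) G :=
      preservesColimit_of_preserves_colimit_cocone h.isColimit
        ((isColimitMapCoconeCofanMkEquiv G _ i).symm h'.isColimit)
    exact preservesColimit_of_iso_diagram G Discrete.natIsoFunctor.symm

end IsCoprod

end IsCoprod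

/-- A class of sets containing the two-point set and closed under disjoint unions. -/
class ClosedUnderSums (S : Type u → Prop) : Prop where
  bool : S (ULift Bool)
  sigma (J : Type u) (X : J → Type u) : S J → (∀ j, S (X j)) → S (Σ j, X j)

namespace DiscreteStoch

variable {S : Type u → Prop}

/-! ### The coinflip structure -/

/-- The pointwise midpoints of Kleisli maps. -/
noncomputable def coinflipStructure (S : Type u → Prop) : CoinflipStructure (DiscreteStoch S) where
  midpoint _ _ :=
    { m := fun f g => ⟨fun x => PMF.mid (f.ker x) (g.ker x)⟩
      idem := fun f => hom_ext fun x => (PMF.midpointAlgebra _).idem (f.ker x)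
      comm := fun f g => hom_ext fun x => (PMF.midpointAlgebra _).comm (f.ker x) (g.ker x)
      interchange := fun f g h k => hom_ext fun x =>
        (PMF.midpointAlgebra _).interchange (f.ker x) (g.ker x) (h.ker x) (k.ker x) }
  precomp h f g := hom_ext fun x => PMF.bind_mid (h.ker x) f.ker g.ker
  postcomp f g h := hom_ext fun x => PMF.mid_bind (f.ker x) (g.ker x) h.ker

/-- Midpoints are pointwise, so the system is solved in `PMF Y.carrier` with the point of `X`
carried along as a parameter. -/
theorem coinflipStructure_isIterable (X Y : DiscreteStoch S) :
    ((coinflipStructure S).midpoint X Y).IsIterable := by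
  intro T s
  obtain ⟨t, ht, hu⟩ := PMF.midpointAlgebra_isIterable (Y := Y.carrier) (T × X.carrier)
    fun a => (((s a.1).1, a.2), (s a.1).2.ker a.2)
  refine ⟨fun a => ⟨fun x => t (a, x)⟩, fun a => hom_ext fun x => ht (a, x), fun t' ht' => ?_⟩
  have := hu (fun a => (t' a.1).ker a.2) fun a => congrFun (congrArg Hom.ker (ht' a.1)) a.2
  exact funext fun a => hom_ext fun x => congrFun this (a, x)

variable [hS : ClosedUnderProducts S]

theorem isExternallyIterableCoinflip : IsExternallyIterableCoinflip (DiscreteStoch S) :=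
  ⟨coinflipStructure S, coinflipStructure_isIterable⟩

/-! ### Deterministic morphisms -/

instance deterministic_ofFun {X Y : DiscreteStoch S} (f : X.carrier → Y.carrier) :
    Deterministic (ofFun f : X ⟶ Y) where
  hom_counit := MarkovCategory.discard_natural _
  hom_comul := by
    rw [copy_eq, copy_eq, ofFun_tensorHom]
    erw [ofFun_comp, ofFun_comp]

/-- Copying sends p to its image on the diagonal, whereas two independent samples give p ⊗ p.
Equality forces p(a)p(b) = 0 for a ≠ b, so p is concentrated at one point. -/
theorem exists_eq_ofFun {X Y : DiscreteStoch S} (f : X ⟶ Y) [Deterministic f] :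
    ∃ g : X.carrier → Y.carrier, f = ofFun g := by
  classical
  have key : ∀ x, ∃ y, f.ker x = PMF.pure y := by
    intro x
    have h := congrFun (congrArg Hom.ker (Deterministic.copy_natural f)) x
    rw [copy_eq, copy_eq] at h
    change (f.ker x).bind (fun y => PMF.pure (y, y)) =
      (PMF.pure (x, x)).bind (fun z => prodDist (f.ker z.1) (f.ker z.2)) at h
    rw [PMF.pure_bind] at h
    generalize f.ker x = p at h
    have hp : ∀ a b, a ≠ b → p a * p b = 0 := by
      intro a b hab
      have h₁ := congrArg (fun q : PMF _ => q (a, b)) h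
      simp only [prodDist, PMF.bind_apply, PMF.pure_apply, Prod.mk.injEq] at h₁
      have h₂ : ∑' y, p y * (if a = y ∧ b = y then 1 else 0) = 0 := by
        rw [ENNReal.tsum_eq_zero]
        intro y
        rw [if_neg, mul_zero]
        rintro ⟨rfl, rfl⟩
        exact hab rfl
      rw [h₂] at h₁
      have h₃ := ENNReal.tsum_eq_zero.1 h₁.symm a
      rcases mul_eq_zero.1 h₃ with h₃ | h₃
      · rw [h₃, zero_mul]
      · have h₄ := ENNReal.tsum_eq_zero.1 h₃ b
        simp only [and_self, if_true, mul_one] at h₄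
        rw [h₄, mul_zero]
    obtain ⟨y, hy⟩ := p.support_nonempty
    refine ⟨y, PMF.ext fun z => ?_⟩
    have hz : ∀ z, z ≠ y → p z = 0 := fun z hzy =>
      (mul_eq_zero.1 (hp z y hzy)).resolve_right ((PMF.mem_support_iff _ _).1 hy)
    rw [PMF.pure_apply]
    split_ifs with hzy
    · rw [hzy, ← p.tsum_coe, tsum_eq_single y hz]
    · exact hz z hzy
  choose g hg using key
  exact ⟨g, hom_ext hg⟩

/-! ### Coproducts -/

variable [hS' : ClosedUnderSums S]

/-- The disjoint union of a family. -/
abbrev sigma {J : Type u} (hJ : S J) (X : J → DiscreteStoch S) : DiscreteStoch S :=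
  ⟨Σ j, (X j).carrier, hS'.sigma _ _ hJ fun j => (X j).mem⟩

/-- The inclusion of a summand. -/
noncomputable abbrev sigmaInj {J : Type u} (hJ : S J) (X : J → DiscreteStoch S) (j : J) :
    X j ⟶ sigma hJ X :=
  ofFun fun x => ⟨j, x⟩

theorem isCoprod_sigmaInj {J : Type u} (hJ : S J) (X : J → DiscreteStoch S) :
    IsCoprod (sigmaInj hJ X) := fun Z g =>
  ⟨⟨fun x => (g x.1).ker x.2⟩, fun j => hom_ext fun x => PMF.pure_bind _ _, fun m hm =>
    hom_ext fun x => by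
      change _ = (g x.1).ker x.2
      rw [← hm x.1]
      exact (PMF.pure_bind _ _).symm⟩

theorem isCoprod_whiskerLeft_sigmaInj {J : Type u} (hJ : S J) (X : J → DiscreteStoch S)
    (A : DiscreteStoch S) : IsCoprod fun j => A ◁ sigmaInj hJ X j := fun Z g => by
  have key : ∀ j, A ◁ sigmaInj hJ X j =
      (ofFun fun x : A.carrier × (X j).carrier => (x.1, (⟨j, x.2⟩ : Σ j, (X j).carrier))) :=
    fun j => whiskerLeft_ofFun _
  simp only [key]
  refine ⟨⟨fun x => (g x.2.1).ker (x.1, x.2.2)⟩, fun j => hom_ext fun x => PMF.pure_bind _ _,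
    fun m hm => hom_ext fun x => ?_⟩
  change _ = (g x.2.1).ker (x.1, x.2.2)
  rw [← hm x.2.1]
  exact (PMF.pure_bind _ _).symm

/-- Deterministic components are functions, so their copairing is again a function. Uniqueness is
inherited from the coproduct in the whole category. -/
theorem isCoprod_det_sigmaInj {J : Type u} (hJ : S J) (X : J → Det (DiscreteStoch S)) :
    IsCoprod (P := (⟨sigma hJ fun j => (X j).obj⟩ : Det (DiscreteStoch S)))
      (fun j => (⟨sigmaInj hJ (fun j => (X j).obj) j, deterministic_ofFun _⟩ : X j ⟶ _)) :=
    fun Z g => by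
  have key : ∀ j, ∃ f : (X j).obj.carrier → Z.obj.carrier, (g j).hom = ofFun f := fun j => by
    have : Deterministic (g j).hom := (g j).property
    exact exists_eq_ofFun _
  choose f hf using key
  refine ⟨⟨ofFun fun x => f x.1 x.2, deterministic_ofFun _⟩, fun j => ?_, fun m hm => ?_⟩
  · refine WideSubcategory.hom_ext _ ?_
    rw [hf]
    exact ofFun_comp _ _
  · refine WideSubcategory.hom_ext _ ((isCoprod_sigmaInj hJ fun j => (X j).obj).hom_ext fun j => ?_)
    refine Eq.trans (congrArg InducedWideCategory.Hom.hom (hm j)) ?_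
    rw [hf]
    exact DiscreteStoch.hom_ext fun x =>
      (PMF.pure_bind (⟨j, x⟩ : Σ j, (X j).obj.carrier) fun y => PMF.pure (f y.1 y.2)).symm

theorem isDistributiveMarkov : IsDistributiveMarkov (DiscreteStoch S) S where
  hasCoproducts _ hJ := IsCoprod.hasColimitsOfShape fun X => ⟨_, _, isCoprod_det_sigmaInj hJ X⟩
  inclusion_preserves _ hJ := IsCoprod.preservesColimitsOfShape _ fun X =>
    ⟨_, _, isCoprod_det_sigmaInj hJ X, isCoprod_sigmaInj hJ fun j => (X j).obj⟩
  tensor_preserves _ hJ A := IsCoprod.preservesColimitsOfShape _ fun X =>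
    ⟨_, _, isCoprod_sigmaInj hJ X, isCoprod_whiskerLeft_sigmaInj hJ X A⟩

end DiscreteStoch

/-! ### Closure of the three classes of sets under disjoint unions -/

instance (κ : Cardinal.{u}) [hκ : Fact κ.IsRegular] : ClosedUnderSums (CardLT κ) where
  bool := (Cardinal.lt_aleph0_of_finite _).trans_le hκ.out.aleph0_le
  sigma J X hJ hX := by
    change Cardinal.mk (Σ j, X j) < κ
    rw [Cardinal.mk_sigma]
    refine Cardinal.sum_lt_of_isRegular hκ.out hJ hX

instance : ClosedUnderSums IsFiniteSet.{u} where
  bool := inferInstanceAs (Finite (ULift Bool))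
  sigma J X hJ hX := by
    have : Finite J := hJ
    have : ∀ j, Finite (X j) := hX
    exact inferInstanceAs (Finite (Σ j, X j))

instance : ClosedUnderSums IsSet.{u} := ⟨trivial, fun _ _ _ _ => trivial⟩

/-! ### Functors preserving binary copowers preserve midpoints -/

section

variable {C : Type u₁} [Category.{v₁} C] {D : Type u₂} [Category.{v₂} D]

/-- The unique isomorphism between two coproducts of the same family. -/
noncomputable def IsCoprod.uniqueIso {J : Type u} {X : J → C} {P Q : C} {i : ∀ j, X j ⟶ P}
    {i' : ∀ j, X j ⟶ Q} (h : IsCoprod i) (h' : IsCoprod i') : P ≅ Q where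
  hom := h.desc i'
  inv := h'.desc i
  hom_inv_id := h.hom_ext fun j => by simp
  inv_hom_id := h'.hom_ext fun j => by simp

theorem IsCoprod.uniqueIso_hom {J : Type u} {X : J → C} {P Q : C} {i : ∀ j, X j ⟶ P}
    {i' : ∀ j, X j ⟶ Q} (h : IsCoprod i) (h' : IsCoprod i') (j : J) :
    i j ≫ (h.uniqueIso h').hom = i' j :=
  h.fac _ _

theorem IsCoprod.uniqueIso_inv {J : Type u} {X : J → C} {P Q : C} {i : ∀ j, X j ⟶ P}
    {i' : ∀ j, X j ⟶ Q} (h : IsCoprod i) (h' : IsCoprod i') (j : J) :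
    i' j ≫ (h.uniqueIso h').inv = i j :=
  h'.fac _ _

/-- A functor preserving the copower of `X` by the two-point set preserves midpoints of morphisms
out of `X`, by an argument of Eckmann–Hilton type. -/
theorem CoinflipStructure.map_midpoint (M : CoinflipStructure C) (N : CoinflipStructure D)
    (G : C ⥤ D) {X P : C} {i : ULift.{u} Bool → (X ⟶ P)} (hi : IsCoprod (X := fun _ => X) i)
    (hG : IsCoprod (X := fun _ => G.obj X) fun j => G.map (i j)) {Y : C} (f g : X ⟶ Y) :
    G.map ((M.midpoint X Y).m f g) = (N.midpoint _ _).m (G.map f) (G.map g) := by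
  -- A fair coin toss recorded in the copower: it is invariant under exchanging the outcomes, it is
  -- undone by forgetting them, and every midpoint of morphisms out of `X` factors through it.
  let w : X ⟶ P := (M.midpoint X P).m (i ⟨true⟩) (i ⟨false⟩)
  let swap : P ⟶ P := hi.desc fun j => i ⟨!j.down⟩
  let fold : P ⟶ X := hi.desc fun _ => 𝟙 X
  have hswap : w ≫ swap = w := by
    simp only [w, swap]
    rw [M.postcomp, hi.fac, hi.fac, (M.midpoint X P).comm]
    rfl
  have hfold : w ≫ fold = 𝟙 X := by
    simp only [w, fold]
    rw [M.postcomp, hi.fac, hi.fac, (M.midpoint X X).idem]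
  let c : G.obj X ⟶ G.obj P := (N.midpoint _ _).m (G.map (i ⟨true⟩)) (G.map (i ⟨false⟩))
  have hc : (N.midpoint _ _).m (𝟙 (G.obj P)) (G.map swap) = G.map fold ≫ c := by
    refine hG.hom_ext fun j => ?_
    rw [N.precomp, Category.comp_id, ← Category.assoc, ← G.map_comp, ← G.map_comp, hi.fac, hi.fac,
      G.map_id, Category.id_comp]
    rcases j with ⟨_ | _⟩
    · exact (N.midpoint _ _).comm _ _
    · rfl
  -- Averaging `G.map w` with its swapped copy changes nothing, yet by `hc` it replaces the coin of
  -- `C` by that of `D`.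
  have hw : G.map w = c := by
    calc G.map w = (N.midpoint _ _).m (G.map w) (G.map w) := ((N.midpoint _ _).idem _).symm
      _ = (N.midpoint _ _).m (G.map w ≫ 𝟙 _) (G.map w ≫ G.map swap) := by
        rw [Category.comp_id, ← G.map_comp, hswap]
      _ = G.map w ≫ G.map fold ≫ c := by rw [← N.precomp, hc]
      _ = c := by rw [← Category.assoc, ← G.map_comp, hfold, G.map_id, Category.id_comp]
  have hfg : (M.midpoint X Y).m f g = w ≫ hi.desc fun j => if j.down then f else g := by
    simp only [w]
    rw [M.postcomp, hi.fac, hi.fac]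
    rfl
  rw [hfg, G.map_comp, hw]
  simp only [c]
  rw [N.postcomp, ← G.map_comp, ← G.map_comp, hi.fac, hi.fac]
  rfl

end

/-! ### States -/

section States

variable {C : Type u₂} [Category.{v₂} C] [MonoidalCategory C]

/-- The tensor product of two states. -/
def tensorState {P Q : C} (a : 𝟙_ C ⟶ P) (b : 𝟙_ C ⟶ Q) : 𝟙_ C ⟶ P ⊗ Q :=
  (λ_ (𝟙_ C)).inv ≫ (a ⊗ₘ b)

variable {P P' Q Q' R : C} (a : 𝟙_ C ⟶ P) (b : 𝟙_ C ⟶ Q) (c : 𝟙_ C ⟶ R)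

theorem tensorState_tensorHom (f : P ⟶ P') (g : Q ⟶ Q') :
    tensorState a b ≫ (f ⊗ₘ g) = tensorState (a ≫ f) (b ≫ g) := by
  simp [tensorState]

theorem tensorState_whiskerRight (f : P ⟶ P') :
    tensorState a b ≫ f ▷ Q = tensorState (a ≫ f) b := by
  rw [← tensorHom_id, tensorState_tensorHom, Category.comp_id]

theorem tensorState_whiskerLeft (g : Q ⟶ Q') :
    tensorState a b ≫ P ◁ g = tensorState a (b ≫ g) := by
  rw [← id_tensorHom, tensorState_tensorHom, Category.comp_id]

theorem tensorState_eq_left : tensorState a b = a ≫ (ρ_ P).inv ≫ P ◁ b := by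
  rw [rightUnitor_inv_naturality_assoc, tensorState, MonoidalCategory.tensorHom_def, unitors_inv_equal]

theorem tensorState_eq_right : tensorState a b = b ≫ (λ_ Q).inv ≫ a ▷ Q := by
  rw [leftUnitor_inv_naturality_assoc, tensorState, MonoidalCategory.tensorHom_def']

theorem tensorState_associator :
    tensorState (tensorState a b) c ≫ (α_ P Q R).hom = tensorState a (tensorState b c) := by
  rw [tensorState_eq_right _ c, tensorState_eq_right a b, tensorState_eq_right a,
    tensorState_eq_right b c]
  simp

theorem tensorState_braiding [BraidedCategory C] :
    tensorState a b ≫ (β_ P Q).hom = tensorState b a := by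
  simp only [tensorState, Category.assoc, BraidedCategory.braiding_naturality]
  rw [← Category.assoc]
  congr 1
  rw [Iso.inv_comp_eq]
  simp [unitors_equal]

theorem state_copy [MarkovCategory C] [Deterministic a] : a ≫ Δ[P] = tensorState a a := by
  rw [Deterministic.copy_natural, CopyDiscardCategory.copy_unit]
  rfl

/-- A coinflip structure assumes nothing about tensor products, but tensoring with a fixed state is
postcomposition with a fixed morphism. -/
theorem CoinflipStructure.tensorState_left (M : CoinflipStructure C) (a a' : 𝟙_ C ⟶ P)
    (b : 𝟙_ C ⟶ Q) : tensorState ((M.midpoint _ _).m a a') b =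
      (M.midpoint _ _).m (tensorState a b) (tensorState a' b) := by
  simp only [tensorState_eq_left]
  exact M.postcomp _ _ _

theorem CoinflipStructure.tensorState_right (M : CoinflipStructure C) (a : 𝟙_ C ⟶ P)
    (b b' : 𝟙_ C ⟶ Q) : tensorState a ((M.midpoint _ _).m b b') =
      (M.midpoint _ _).m (tensorState a b) (tensorState a b') := by
  simp only [tensorState_eq_right]
  exact M.postcomp _ _ _

/-- `P ⊗ Q` is the Y-indexed copower of `P ⊗ 𝟙_ C ≅ P`, and `P` is itself the X-indexed copower of
the unit. -/
theorem IsCoprod.tensorState {X : Type u} {Y : Type v} {i : X → (𝟙_ C ⟶ P)} {j : Y → (𝟙_ C ⟶ Q)}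
    (hi : IsCoprod (X := fun _ => 𝟙_ C) i) (hj : IsCoprod (X := fun _ => 𝟙_ C) j)
    [PreservesColimitsOfShape (Discrete Y) (tensorLeft P)] :
    IsCoprod (X := fun _ => 𝟙_ C) fun p : X × Y => _root_.tensorState (i p.1) (j p.2) := by
  have hP : IsCoprod (X := fun _ => P ⊗ 𝟙_ C) fun y => P ◁ j y := hj.map (tensorLeft P)
  simp only [tensorState_eq_left]
  intro Z g
  refine ⟨hP.desc fun y => (ρ_ P).hom ≫ hi.desc fun x => g (x, y), fun p => ?_, fun m hm => ?_⟩
  · simp only [Category.assoc]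
    rw [hP.fac, Iso.inv_hom_id_assoc, hi.fac]
  · refine hP.hom_ext fun y => ?_
    rw [hP.fac, ← Iso.inv_comp_eq]
    refine hi.hom_ext fun x => ?_
    rw [hi.fac, ← hm]
    simp

end States

/-! ### Copowers of the tensor unit -/

namespace IsDistributiveMarkov

variable {C : Type u₂} [Category.{v₂} C] [MonoidalCategory C] [MarkovCategory C]
  {S : Type u → Prop}

/-- The coproduct is formed among deterministic morphisms, so that its injections can be copied, and
is then transported along the inclusion. -/
theorem exists_copower (hC : IsDistributiveMarkov C S) {X : Type u} (hX : S X) : ∃ (P : C) (i : X → (𝟙_ C ⟶ P)),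
    (∀ x, Deterministic (i x)) ∧ IsCoprod (X := fun _ => 𝟙_ C) i := by
  have := hC.hasCoproducts X hX
  have := hC.inclusion_preserves X hX
  obtain ⟨P, i, hi⟩ := IsCoprod.exists_of_hasColimitsOfShape (C := Det C) fun _ : X => ⟨𝟙_ C⟩
  exact ⟨P.obj, fun x => (i x).hom, fun x => (i x).property, hi.map (Det.inclusion C)⟩

end IsDistributiveMarkov

/-! ### The functor out of the Kleisli category -/

namespace DiscreteStoch

variable {C : Type u₂} [Category.{v₂} C] [MonoidalCategory C] [MarkovCategory C]
  {S : Type u → Prop}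
  (hC : IsDistributiveMarkov C S) {M : CoinflipStructure C}
  (hM : ∀ X Y : C, (M.midpoint X Y).IsIterable)

/-- The copower of the unit object by a set. -/
noncomputable def copower (X : DiscreteStoch S) : C := (hC.exists_copower X.mem).choose

/-- The deterministic states of a copower given by the elements of the set. -/
noncomputable def pt {X : DiscreteStoch S} (x : X.carrier) : 𝟙_ C ⟶ copower hC X :=
  (hC.exists_copower X.mem).choose_spec.choose x

instance deterministic_pt {X : DiscreteStoch S} (x : X.carrier) : Deterministic (pt hC x) :=
  (hC.exists_copower X.mem).choose_spec.choose_spec.1 x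

theorem isCoprod_pt (X : DiscreteStoch S) : IsCoprod (X := fun _ => 𝟙_ C) (pt hC (X := X)) :=
  (hC.exists_copower X.mem).choose_spec.choose_spec.2

/-- The state of a copower given by a distribution. -/
noncomputable def mixture {X : DiscreteStoch S} (p : PMF X.carrier) : 𝟙_ C ⟶ copower hC X :=
  (hM _ _).lift (pt hC) p

@[simp]
theorem mixture_pure {X : DiscreteStoch S} (x : X.carrier) :
    mixture hC hM (PMF.pure x) = pt hC x :=
  (hM _ _).lift_pure x

theorem mixture_mid {X : DiscreteStoch S} (p q : PMF X.carrier) :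
    mixture hC hM (PMF.mid p q) = (M.midpoint _ _).m (mixture hC hM p) (mixture hC hM q) :=
  (hM _ _).lift_mid p q

variable [hS : ClosedUnderProducts S]

/-- The morphism of copowers given by a Kleisli map. -/
noncomputable def copowerMap {X Y : DiscreteStoch S} (k : X ⟶ Y) : copower hC X ⟶ copower hC Y :=
  (isCoprod_pt hC X).desc fun x => mixture hC hM (k.ker x)

@[simp]
theorem pt_copowerMap {X Y : DiscreteStoch S} (k : X ⟶ Y) (x : X.carrier) :
    pt hC x ≫ copowerMap hC hM k = mixture hC hM (k.ker x) :=
  (isCoprod_pt hC X).fac _ _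

/-- Both sides are midpoint homomorphisms in `p` and agree on Dirac distributions. This is what
makes Kleisli composition go to composition. -/
theorem mixture_copowerMap {X Y : DiscreteStoch S} (k : X ⟶ Y) (p : PMF X.carrier) :
    mixture hC hM p ≫ copowerMap hC hM k = mixture hC hM (p.bind k.ker) := by
  refine (hM _ _).hom_ext (φ := fun p => mixture hC hM p ≫ copowerMap hC hM k)
    (ψ := fun p => mixture hC hM (p.bind k.ker)) (fun p q => ?_) (fun p q => ?_) (fun x => ?_) p
  · rw [mixture_mid, M.postcomp]
  · rw [PMF.mid_bind, mixture_mid]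
  · rw [mixture_pure, pt_copowerMap, PMF.pure_bind]

/-- The functor sending a set to its copower. -/
@[simps]
noncomputable def copowerFunctor : DiscreteStoch S ⥤ C where
  obj := copower hC
  map k := copowerMap hC hM k
  map_id X := (isCoprod_pt hC X).hom_ext fun x => by
    rw [pt_copowerMap, id_ker, mixture_pure, Category.comp_id]
  map_comp k l := (isCoprod_pt hC _).hom_ext fun x => by
    rw [← Category.assoc, pt_copowerMap, pt_copowerMap, mixture_copowerMap, comp_ker]

theorem isCoprod_tensorState_pt (X Y : DiscreteStoch S) : IsCoprod (X := fun _ => 𝟙_ C)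
    fun p : X.carrier × Y.carrier => tensorState (pt hC p.1) (pt hC p.2) := by
  have := hC.tensor_preserves Y.carrier Y.mem (copower hC X)
  exact (isCoprod_pt hC X).tensorState (isCoprod_pt hC Y)

/-- Copowers turn products of sets into tensor products. -/
noncomputable def copowerTensorIso (X Y : DiscreteStoch S) :
    copower hC X ⊗ copower hC Y ≅ copower hC (X ⊗ Y) :=
  (isCoprod_tensorState_pt hC X Y).uniqueIso (isCoprod_pt hC (X ⊗ Y))

theorem pt_copowerTensorIso {X Y : DiscreteStoch S} (x : X.carrier) (y : Y.carrier) :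
    tensorState (pt hC x) (pt hC y) ≫ (copowerTensorIso hC X Y).hom =
      pt hC (X := X ⊗ Y) (x, y) :=
  (isCoprod_tensorState_pt hC X Y).uniqueIso_hom (isCoprod_pt hC (X ⊗ Y)) (x, y)

theorem pt_copowerTensorIso_inv {X Y : DiscreteStoch S} (x : X.carrier) (y : Y.carrier) :
    pt hC (X := X ⊗ Y) (x, y) ≫ (copowerTensorIso hC X Y).inv =
      tensorState (pt hC x) (pt hC y) :=
  (isCoprod_tensorState_pt hC X Y).uniqueIso_inv (isCoprod_pt hC (X ⊗ Y)) (x, y)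

/-- Both sides preserve midpoints in each variable, so freeness reduces first `p` and then `q` to
Dirac distributions. -/
theorem mixture_copowerTensorIso {X Y : DiscreteStoch S} (p : PMF X.carrier) (q : PMF Y.carrier) :
    tensorState (mixture hC hM p) (mixture hC hM q) ≫ (copowerTensorIso hC X Y).hom =
      mixture hC hM (X := X ⊗ Y) (prodDist p q) := by
  refine (hM _ _).hom_ext (φ := fun p => tensorState (mixture hC hM p) (mixture hC hM q) ≫
      (copowerTensorIso hC X Y).hom) (ψ := fun p => mixture hC hM (X := X ⊗ Y) (prodDist p q))
    (fun p p' => ?_) (fun p p' => ?_) (fun x => ?_) p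
  · rw [mixture_mid, M.tensorState_left, M.postcomp]
  · rw [prodDist, PMF.mid_bind]
    exact mixture_mid hC hM (X := X ⊗ Y) _ _
  refine (hM _ _).hom_ext (φ := fun q => tensorState (mixture hC hM (PMF.pure x))
      (mixture hC hM q) ≫ (copowerTensorIso hC X Y).hom)
    (ψ := fun q => mixture hC hM (X := X ⊗ Y) (prodDist (PMF.pure x) q))
    (fun q q' => ?_) (fun q q' => ?_) (fun y => ?_) q
  · rw [mixture_mid, M.tensorState_right, M.postcomp]
  · simp only [prodDist, PMF.pure_bind]
    rw [PMF.mid_bind]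
    exact mixture_mid hC hM (X := X ⊗ Y) _ _
  · rw [mixture_pure, mixture_pure, pt_copowerTensorIso, prodDist_pure]
    exact (mixture_pure hC hM (X := X ⊗ Y) (x, y)).symm

theorem isCoprod_id_unit : IsCoprod (X := fun _ => 𝟙_ C)
    fun _ : (𝟙_ (DiscreteStoch S) : DiscreteStoch S).carrier => 𝟙 (𝟙_ C) := fun Z g =>
  ⟨g PUnit.unit, fun _ => Category.id_comp _, fun m hm => by
    rw [← hm PUnit.unit, Category.id_comp]⟩

/-- The copower by the one-point set is the unit object. -/
noncomputable def copowerUnitIso : 𝟙_ C ≅ copower hC (𝟙_ (DiscreteStoch S)) :=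
  isCoprod_id_unit.uniqueIso (isCoprod_pt hC _)

theorem copowerUnitIso_hom :
    (copowerUnitIso hC).hom = pt hC (X := 𝟙_ (DiscreteStoch S)) PUnit.unit := by
  have := isCoprod_id_unit.uniqueIso_hom (isCoprod_pt hC (𝟙_ (DiscreteStoch S))) PUnit.unit
  rwa [Category.id_comp] at this

theorem pt_copowerMap_of_eq {X Y : DiscreteStoch S} (k : X ⟶ Y) (x : X.carrier) (y : Y.carrier)
    (h : k.ker x = PMF.pure y) : pt hC x ≫ copowerMap hC hM k = pt hC y := by
  rw [pt_copowerMap, h, mixture_pure]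

theorem copowerTensorIso_natural_left {X Y : DiscreteStoch S} (k : X ⟶ Y) (Z : DiscreteStoch S) :
    copowerMap hC hM k ▷ copower hC Z ≫ (copowerTensorIso hC Y Z).hom =
      (copowerTensorIso hC X Z).hom ≫ copowerMap hC hM (k ▷ Z) :=
  (isCoprod_tensorState_pt hC X Z).hom_ext fun p => by
    rw [← Category.assoc, ← Category.assoc, tensorState_whiskerRight, pt_copowerTensorIso,
      pt_copowerMap, pt_copowerMap, ← mixture_pure hC hM p.2, mixture_copowerTensorIso]
    rfl

theorem copowerTensorIso_natural_right (Z : DiscreteStoch S) {X Y : DiscreteStoch S} (k : X ⟶ Y) :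
    copower hC Z ◁ copowerMap hC hM k ≫ (copowerTensorIso hC Z Y).hom =
      (copowerTensorIso hC Z X).hom ≫ copowerMap hC hM (Z ◁ k) :=
  (isCoprod_tensorState_pt hC Z X).hom_ext fun p => by
    rw [← Category.assoc, ← Category.assoc, tensorState_whiskerLeft, pt_copowerTensorIso,
      pt_copowerMap, pt_copowerMap, ← mixture_pure hC hM p.1, mixture_copowerTensorIso]
    rfl

theorem copowerTensorIso_associativity (X Y Z : DiscreteStoch S) :
    (copowerTensorIso hC X Y).hom ▷ copower hC Z ≫ (copowerTensorIso hC (X ⊗ Y) Z).hom ≫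
        copowerMap hC hM (α_ X Y Z).hom =
      (α_ (copower hC X) (copower hC Y) (copower hC Z)).hom ≫
        copower hC X ◁ (copowerTensorIso hC Y Z).hom ≫ (copowerTensorIso hC X (Y ⊗ Z)).hom := by
  have := hC.tensor_preserves Z.carrier Z.mem (copower hC X ⊗ copower hC Y)
  refine ((isCoprod_tensorState_pt hC X Y).tensorState (isCoprod_pt hC Z)).hom_ext ?_
  rintro ⟨⟨x, y⟩, z⟩
  dsimp only
  rw [← Category.assoc, tensorState_whiskerRight, pt_copowerTensorIso, ← Category.assoc,
    pt_copowerTensorIso hC (X := X ⊗ Y) (x, y) z,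
    pt_copowerMap_of_eq hC hM (α_ X Y Z).hom ((x, y), z) (x, (y, z)) rfl, ← Category.assoc,
    tensorState_associator, ← Category.assoc, tensorState_whiskerLeft, pt_copowerTensorIso]
  exact (pt_copowerTensorIso hC (Y := Y ⊗ Z) x (y, z)).symm

theorem copowerTensorIso_left_unitality (X : DiscreteStoch S) :
    (λ_ (copower hC X)).hom = (copowerUnitIso hC).hom ▷ copower hC X ≫
      (copowerTensorIso hC (𝟙_ _) X).hom ≫ copowerMap hC hM (λ_ X).hom := by
  rw [← cancel_epi (λ_ (copower hC X)).inv, Iso.inv_hom_id]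
  refine (isCoprod_pt hC X).hom_ext fun x => ?_
  have h := tensorState_eq_right (pt hC (X := 𝟙_ (DiscreteStoch S)) PUnit.unit) (pt hC x)
  rw [Category.comp_id, copowerUnitIso_hom, ← Category.assoc, ← Category.assoc, Category.assoc _ _
    (_ ▷ _), ← h, ← Category.assoc, pt_copowerTensorIso]
  exact (pt_copowerMap_of_eq hC hM (λ_ X).hom (PUnit.unit, x) x rfl).symm

theorem copowerTensorIso_right_unitality (X : DiscreteStoch S) :
    (ρ_ (copower hC X)).hom = copower hC X ◁ (copowerUnitIso hC).hom ≫
      (copowerTensorIso hC X (𝟙_ _)).hom ≫ copowerMap hC hM (ρ_ X).hom := by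
  rw [← cancel_epi (ρ_ (copower hC X)).inv, Iso.inv_hom_id]
  refine (isCoprod_pt hC X).hom_ext fun x => ?_
  have h := tensorState_eq_left (pt hC x) (pt hC (X := 𝟙_ (DiscreteStoch S)) PUnit.unit)
  rw [Category.comp_id, copowerUnitIso_hom, ← Category.assoc, ← Category.assoc, Category.assoc _ _
    (_ ◁ _), ← h, ← Category.assoc, pt_copowerTensorIso]
  exact (pt_copowerMap_of_eq hC hM (ρ_ X).hom (x, PUnit.unit) x rfl).symm

theorem copowerTensorIso_braided (X Y : DiscreteStoch S) :
    (copowerTensorIso hC X Y).hom ≫ copowerMap hC hM (β_ X Y).hom =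
      (β_ (copower hC X) (copower hC Y)).hom ≫ (copowerTensorIso hC Y X).hom :=
  (isCoprod_tensorState_pt hC X Y).hom_ext fun p => by
    rw [← Category.assoc, pt_copowerTensorIso, ← Category.assoc, tensorState_braiding,
      pt_copowerTensorIso]
    exact pt_copowerMap_of_eq hC hM (β_ X Y).hom p (p.2, p.1) rfl

/-- Points are jointly epic, and copying a deterministic point yields two copies of it. -/
theorem copowerMap_copy (X : DiscreteStoch S) :
    copowerMap hC hM Δ[X] ≫ (copowerTensorIso hC X X).inv = Δ[copower hC X] :=
  (isCoprod_pt hC X).hom_ext fun x => by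
    rw [← Category.assoc, pt_copowerMap_of_eq hC hM Δ[X] x (x, x) rfl, pt_copowerTensorIso_inv,
      state_copy]

/-- The monoidal structure on the copower functor. -/
noncomputable def copowerCoreMonoidal : (copowerFunctor hC hM).CoreMonoidal where
  εIso := copowerUnitIso hC
  μIso := copowerTensorIso hC
  μIso_hom_natural_left := copowerTensorIso_natural_left hC hM
  μIso_hom_natural_right := fun Z k => copowerTensorIso_natural_right hC hM Z k
  associativity := copowerTensorIso_associativity hC hM
  left_unitality := copowerTensorIso_left_unitality hC hM
  right_unitality := copowerTensorIso_right_unitality hC hM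

/-- The copower functor as a Markov functor. -/
noncomputable def copowerMarkovFunctor : MarkovFunctor (DiscreteStoch S) C where
  toFunctor := copowerFunctor hC hM
  braided :=
    { toMonoidal := (copowerCoreMonoidal hC hM).toMonoidal
      braided := copowerTensorIso_braided hC hM }
  map_copy := copowerMap_copy hC hM

variable [hS' : ClosedUnderSums S]

theorem isCoprod_copowerMap_sigmaInj {J : Type u} (hJ : S J) (X : J → DiscreteStoch S) :
    IsCoprod fun j => copowerMap hC hM (sigmaInj hJ X j) := fun Z g => by
  have key : ∀ (j : J) (x : (X j).carrier),
      pt hC x ≫ copowerMap hC hM (sigmaInj hJ X j) = pt hC (X := sigma hJ X) ⟨j, x⟩ :=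
    fun j x => pt_copowerMap_of_eq hC hM _ _ _ rfl
  refine ⟨(isCoprod_pt hC (sigma hJ X)).desc fun x => pt hC x.2 ≫ g x.1,
    fun j => (isCoprod_pt hC (X j)).hom_ext fun x => ?_,
    fun m hm => (isCoprod_pt hC (sigma hJ X)).hom_ext fun x => ?_⟩
  · rw [← Category.assoc, key]
    exact (isCoprod_pt hC (sigma hJ X)).fac _ _
  · refine Eq.trans ?_ ((isCoprod_pt hC (sigma hJ X)).fac _ _).symm
    rw [← hm x.1, ← Category.assoc, key]

theorem copowerMarkovFunctor_preservesCoproducts :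
    (copowerMarkovFunctor hC hM).PreservesCoproducts S := fun _ hJ =>
  IsCoprod.preservesColimitsOfShape (copowerFunctor hC hM) fun X =>
    ⟨_, _, isCoprod_sigmaInj hJ X, isCoprod_copowerMap_sigmaInj hC hM hJ X⟩

end DiscreteStoch

/-! ### Uniqueness of the functor -/

namespace DiscreteStoch

open Functor.LaxMonoidal

variable {C : Type u₂} [Category.{v₂} C] [MonoidalCategory C] [MarkovCategory C]
  {S : Type u → Prop} [hS : ClosedUnderProducts S]

/-- A distribution as a morphism from the one-point set. -/
noncomputable def state {X : DiscreteStoch S} (p : PMF X.carrier) : 𝟙_ (DiscreteStoch S) ⟶ X :=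
  ⟨fun _ => p⟩

theorem state_comp {X Y : DiscreteStoch S} (p : PMF X.carrier) (k : X ⟶ Y) :
    state p ≫ k = state (p.bind k.ker) := rfl

theorem state_pure_unit :
    state (PMF.pure PUnit.unit : PMF (𝟙_ (DiscreteStoch S) : DiscreteStoch S).carrier) = 𝟙 _ := rfl

theorem tensorState_state {X Y : DiscreteStoch S} (p : PMF X.carrier) (q : PMF Y.carrier) :
    tensorState (state p) (state q) = state (X := X ⊗ Y) (prodDist p q) :=
  hom_ext fun _ => PMF.pure_bind _ _

theorem isCoprod_state_pure (X : DiscreteStoch S) :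
    IsCoprod (X := fun _ => 𝟙_ (DiscreteStoch S)) fun x : X.carrier => state (PMF.pure x) :=
  fun _ g => ⟨⟨fun x => (g x).ker PUnit.unit⟩, fun x => hom_ext fun _ => PMF.pure_bind _ _,
    fun m hm => hom_ext fun x => by
      change _ = (g x).ker PUnit.unit
      rw [← hm x]
      exact (PMF.pure_bind _ _).symm⟩

variable (F G : MarkovFunctor (DiscreteStoch S) C)

/-- The image under a monoidal functor of a distribution, as a state. -/
noncomputable def mapState {X : DiscreteStoch S} (p : PMF X.carrier) :
    𝟙_ C ⟶ F.toFunctor.obj X :=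
  Functor.LaxMonoidal.ε F.toFunctor ≫ F.toFunctor.map (state p)

theorem mapState_comp {X Y : DiscreteStoch S} (p : PMF X.carrier) (k : X ⟶ Y) :
    mapState F p ≫ F.toFunctor.map k = mapState F (p.bind k.ker) := by
  rw [mapState, mapState, Category.assoc, ← F.toFunctor.map_comp, state_comp]

theorem mapState_unit :
    mapState F (X := 𝟙_ (DiscreteStoch S)) (PMF.pure PUnit.unit) = Functor.LaxMonoidal.ε F.toFunctor := by
  rw [mapState, state_pure_unit, F.toFunctor.map_id, Category.comp_id]

theorem tensorState_mapState {X Y : DiscreteStoch S} (p : PMF X.carrier) (q : PMF Y.carrier) :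
    tensorState (mapState F p) (mapState F q) ≫ μ F.toFunctor X Y =
      mapState F (X := X ⊗ Y) (prodDist p q) := by
  rw [mapState, mapState, mapState, ← tensorState_tensorHom, Category.assoc, μ_natural,
    ← Category.assoc, ← tensorState_state, tensorState, tensorState, F.toFunctor.map_comp,
    ← Category.assoc]
  congr 1
  rw [← left_unitality_inv, leftUnitor_inv_naturality_assoc, MonoidalCategory.tensorHom_def']
  simp only [Category.assoc]

variable {F G}

theorem isCoprod_mapState (hF : F.PreservesCoproducts S) (X : DiscreteStoch S) :
    IsCoprod (X := fun _ => 𝟙_ C) fun x : X.carrier => mapState F (PMF.pure x) := by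
  have := hF X.carrier X.mem
  exact ((isCoprod_state_pure X).map F.toFunctor).iso_comp
    fun _ => Functor.Monoidal.εIso F.toFunctor

/-- The comparison isomorphism between two Markov functors preserving coproducts. -/
noncomputable def comparisonApp (hF : F.PreservesCoproducts S) (hG : G.PreservesCoproducts S)
    (X : DiscreteStoch S) : F.toFunctor.obj X ≅ G.toFunctor.obj X :=
  (isCoprod_mapState hF X).uniqueIso (isCoprod_mapState hG X)

theorem mapState_pure_comparisonApp (hF : F.PreservesCoproducts S) (hG : G.PreservesCoproducts S)
    {X : DiscreteStoch S} (x : X.carrier) :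
    mapState F (PMF.pure x) ≫ (comparisonApp hF hG X).hom = mapState G (PMF.pure x) :=
  (isCoprod_mapState hF X).uniqueIso_hom (isCoprod_mapState hG X) x

variable [hS' : ClosedUnderSums S] {M : CoinflipStructure C}

/-- `F` preserves the copower of the unit by the two-point set, so `CoinflipStructure.map_midpoint`
applies. -/
theorem mapState_mid (hF : F.PreservesCoproducts S) {X : DiscreteStoch S} (p q : PMF X.carrier) :
    mapState F (PMF.mid p q) = (M.midpoint _ _).m (mapState F p) (mapState F q) := by
  have := hF _ hS'.bool
  have hi := isCoprod_sigmaInj hS'.bool fun _ => 𝟙_ (DiscreteStoch S)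
  rw [mapState, mapState, mapState, ← M.precomp,
    ← (coinflipStructure S).map_midpoint M F.toFunctor hi (hi.map F.toFunctor)]
  rfl

/-- The comparison is defined by its effect on Dirac states. It extends to all distributions because
both functors preserve midpoints and the hom-sets are iterable. -/
theorem mapState_comparisonApp (hM : ∀ X Y : C, (M.midpoint X Y).IsIterable)
    (hF : F.PreservesCoproducts S) (hG : G.PreservesCoproducts S)
    {X : DiscreteStoch S} (p : PMF X.carrier) :
    mapState F p ≫ (comparisonApp hF hG X).hom = mapState G p := by
  refine (hM _ _).hom_ext (φ := fun p => mapState F p ≫ (comparisonApp hF hG X).hom)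
    (ψ := fun p => mapState G p) (fun p q => ?_) (fun p q => ?_) (fun x => ?_) p
  · rw [mapState_mid (M := M) hF, M.postcomp]
  · rw [mapState_mid (M := M) hG]
  · exact mapState_pure_comparisonApp hF hG x

/-- The comparison isomorphism is natural. -/
noncomputable def comparison (hM : ∀ X Y : C, (M.midpoint X Y).IsIterable)
    (hF : F.PreservesCoproducts S) (hG : G.PreservesCoproducts S) : F.toFunctor ≅ G.toFunctor :=
  NatIso.ofComponents (comparisonApp hF hG) fun {X Y} k =>
    (isCoprod_mapState hF X).hom_ext fun x => by
      rw [← Category.assoc, ← Category.assoc, mapState_comp, mapState_comparisonApp hM,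
        mapState_pure_comparisonApp, mapState_comp]

theorem comparison_isMonoidal (hC : IsDistributiveMarkov C S)
    (hM : ∀ X Y : C, (M.midpoint X Y).IsIterable)
    (hF : F.PreservesCoproducts S) (hG : G.PreservesCoproducts S) :
    NatTrans.IsMonoidal (comparison hM hF hG).hom where
  unit := by
    have := mapState_pure_comparisonApp hF hG (X := 𝟙_ (DiscreteStoch S)) PUnit.unit
    rwa [mapState_unit, mapState_unit] at this
  tensor X Y := by
    have := hC.tensor_preserves Y.carrier Y.mem (F.toFunctor.obj X)
    refine ((isCoprod_mapState hF X).tensorState (isCoprod_mapState hF Y)).hom_ext fun p => ?_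
    change _ ≫ _ ≫ (comparisonApp hF hG (X ⊗ Y)).hom =
      _ ≫ ((comparisonApp hF hG X).hom ⊗ₘ (comparisonApp hF hG Y).hom) ≫ _
    rw [← Category.assoc, tensorState_mapState, mapState_comparisonApp hM, ← Category.assoc,
      tensorState_tensorHom, mapState_pure_comparisonApp, mapState_pure_comparisonApp,
      tensorState_mapState]

/-- Naturality at a Dirac state and compatibility with the unit determine `α` on the jointly epic
points. -/
theorem eq_comparison_hom (hM : ∀ X Y : C, (M.midpoint X Y).IsIterable)
    (hF : F.PreservesCoproducts S) (hG : G.PreservesCoproducts S)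
    (α : F.toFunctor ⟶ G.toFunctor) [NatTrans.IsMonoidal α] : α = (comparison hM hF hG).hom := by
  ext X
  refine (isCoprod_mapState hF X).hom_ext fun x => ?_
  refine Eq.trans ?_ (mapState_pure_comparisonApp hF hG x).symm
  rw [mapState, Category.assoc, α.naturality, ← Category.assoc, NatTrans.IsMonoidal.unit, mapState]

theorem isInitial (S : Type u → Prop) [ClosedUnderProducts S] [ClosedUnderSums S] :
    IsInitialDistributiveIterableCoinflip.{u, u, u + 1, v₂, u₂} S (DiscreteStoch S) where
  distributive := isDistributiveMarkov
  iterable := isExternallyIterableCoinflip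
  exists_functor C _ _ _ hC hC' := by
    obtain ⟨M, hM⟩ := hC'
    exact ⟨copowerMarkovFunctor hC hM, copowerMarkovFunctor_preservesCoproducts hC hM⟩
  unique_functor C _ _ _ hC hC' F G hF hG := by
    obtain ⟨M, hM⟩ := hC'
    exact ⟨comparison hM hF hG, comparison_isMonoidal hC hM hF hG,
      fun α _ => eq_comparison_hom hM hF hG α⟩

end DiscreteStoch

theorem mainTheorem2 :
    (∀ (κ : Cardinal.{u}) [Fact κ.IsRegular],
      IsInitialDistributiveIterableCoinflip.{u, u, u + 1, v₂, u₂} (CardLT κ) (SetDistLT κ)) ∧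
    IsInitialDistributiveIterableCoinflip.{u, u, u + 1, v₂, u₂} IsFiniteSet FinStoch.{u} ∧
    IsInitialDistributiveIterableCoinflip.{u, u, u + 1, v₂, u₂} IsSet SetDist.{u} :=
  ⟨fun κ _ => DiscreteStoch.isInitial (CardLT κ), DiscreteStoch.isInitial IsFiniteSet,
    DiscreteStoch.isInitial IsSet⟩
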